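/- For a complex Hilbert space $\mathfrak D$ let $\mathfrak D^*$ be the space of bounded conjugate-linear functionals on $\mathfrak D$. For a bounded $A\colon\mathfrak D\to\mathfrak D^*$ let $\operatorname{ind}A\in\{0,1,2,\dots,\infty\}$ be the supremum of the dimensions of subspaces $\mathfrak M\subseteq\mathfrak D$ with $\langle Ay,y\rangle<0$ for all $y\in\mathfrak M\setminus\{0\}$; call $A$ uniformly positive if, for some $\varepsilon>0$, $\langle Ay,y\rangle\geqslant\varepsilon\|y\|^2$ for all $y\in\mathfrak D$. Let $\mathfrak H_1,\mathfrak H_2,\mathfrak D_1,\mathfrak D_2$ be complex Hilbert spaces and $I_j\colon\mathfrak D_j\to\mathfrak H_j$ ($j=1,2$) bounded injective operators with dense range. Put $\mathfrak H=\mathfrak H_1\oplus\mathfrak H_2$, $\mathfrak D=\mathfrak D_1\oplus\mathfrak D_2$ (orthogonal sums), $I=I_1\oplus I_2\colon\mathfrak D\to\mathfrak H$, and let $I^*\colon\mathfrak H\to\mathfrak D^*$ be given by $\langle I^*h,y\rangle=\langle h,Iy\rangle_{\mathfrak H}$. For a bounded $T\colon\mathfrak D\to\mathfrak D^*$ let $T^\bullet=(I^*)^{-1}TI^{-1}$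 be the corresponding (in general unbounded) operator in $\mathfrak H$, and let $T_{ij}\colon\mathfrak D_j\to\mathfrak D_i^*$ be the components of $T$. Let $\zeta^-<\zeta^+$ be real and let $T(\lambda)\colon\mathfrak D\to\mathfrak D^*$, $\lambda\in[\zeta^-,\zeta^+]$, be bounded operators depending continuously differentiably on $\lambda$ in the strong operator topology, such that every $[T(\lambda)]^\bullet$ is self-adjoint in $\mathfrak H$. Assume: 1. there is $\varepsilon>0$ such that $\langle T_{22}(\lambda)y,y\rangle\leqslant-\varepsilon\|y\|^2$ for all $\lambda\in[\zeta^-,\zeta^+]$ and $y\in\mathfrak D_2$; 2. the operator function $S(\lambda)=T_{11}(\lambda)-T_{12}(\lambda)[T_{22}(\lambda)]^{-1}T_{21}(\lambda)\colon\mathfrak D_1\to\mathfrak D_1^*$ is continuous in the operator norm on $[\zeta^-,\zeta^+]$, and each of its values is a compact perturbation of a uniformly positive operator. Suppose that all eigenvalues of $T$ in $(\zeta^-,\zeta^+)$ are of negative type, that is, for every $\mu\in(\zeta^-,\zeta^+)$ and every nonzero $y\in\ker T(\mu)$ the function $\lambda\mapsto\langle T(\lambda)y,y\rangle$ has a strictly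 negative derivative at $\mu$. Suppose also that $T(\zeta^-)$ and $T(\zeta^+)$ have bounded inverses. Then the spectrum of $\lambda\mapsto[T(\lambda)]^\bullet$ in $(\zeta^-,\zeta^+)$, i.e. the set of $\mu\in(\zeta^-,\zeta^+)$ for which $[T(\mu)]^\bullet$ has no bounded everywhere defined inverse, is purely discrete: it consists of eigenvalues ($\ker[T(\mu)]^\bullet\ne\{0\}$) of finite multiplicity $\dim\ker[T(\mu)]^\bullet$ and has no accumulation point in $(\zeta^-,\zeta^+)$. Moreover $\operatorname{ind}S(\zeta^\pm)$ are finite, and the total multiplicity of this spectrum equals $\operatorname{ind}S(\zeta^+)-\operatorname{ind}S(\zeta^-)$. -/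

import Mathlib

open Set Topology

noncomputable section

namespace Rigged

/-- The antidual `D*` of `D`: bounded conjugate-linear functionals. A bounded operator
`A : D →L[ℂ] AntiDual D` is the same as a bounded sesquilinear form `⟨A x, y⟩ = A x y`,
linear in `x` and conjugate-linear in `y`. -/
abbrev AntiDual (D : Type*) [NormedAddCommGroup D] [NormedSpace ℂ D] : Type _ :=
  D →L⋆[ℂ] ℂ

section Operators

variable {D E H : Type*}
  [NormedAddCommGroup D] [InnerProductSpace ℂ D]
  [NormedAddCommGroup E] [InnerProductSpace ℂ E]
  [NormedAddCommGroup H] [InnerProductSpace ℂ H]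

/-- The adjoint embedding `I* : H → D*`, `⟨I* h, y⟩ = ⟨h, I y⟩_H`. (Mathlib's inner product is
conjugate-linear in its first argument.) -/
def adjointEmbedding (I : D →L[ℂ] H) : H →L[ℂ] AntiDual D :=
  ((innerSL ℂ).comp I).flip

theorem adjointEmbedding_apply (I : D →L[ℂ] H) (h : H) (y : D) :
    adjointEmbedding I h y = inner ℂ (I y) h := rfl

/-- The relation `{(I y, h) : T y = I* h}` in `H × H`. -/
def bulletGraph (I : D →L[ℂ] H) (T : D →L[ℂ] AntiDual D) : Submodule ℂ (H × H) where
  carrier := {p | ∃ y : D, I y = p.1 ∧ T y = adjointEmbedding I p.2}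
  zero_mem' := ⟨0, by simp, by simp⟩
  add_mem' := by
    rintro p q ⟨y, hy1, hy2⟩ ⟨z, hz1, hz2⟩
    exact ⟨y + z, by simp [hy1, hz1], by simp [hy2, hz2]⟩
  smul_mem' := by
    rintro c p ⟨y, hy1, hy2⟩
    exact ⟨c • y, by simp [hy1], by simp [hy2]⟩

/-- The (in general unbounded) operator `T^• = (I*)⁻¹ T I⁻¹` in `H`, for `I` injective with dense
range; its graph is `bulletGraph I T`. -/
def bullet (I : D →L[ℂ] H) (T : D →L[ℂ] AntiDual D) : H →ₗ.[ℂ] H :=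
  (bulletGraph I T).toLinearPMap

theorem mem_bullet_graph_iff (I : D →L[ℂ] H) (hI : Function.Injective I) (hd : DenseRange I)
    (T : D →L[ℂ] AntiDual D) (x h : H) :
    (x, h) ∈ (bullet I T).graph ↔ ∃ y : D, I y = x ∧ T y = adjointEmbedding I h := by
  have key : ∀ p : H × H, p ∈ bulletGraph I T → p.1 = 0 → p.2 = 0 := by
    rintro ⟨p, q⟩ ⟨y, hy1, hy2⟩ hp
    simp only at hy1 hy2 hp ⊢
    have hy : y = 0 := hI (by rw [hy1, hp, map_zero])
    refine hd.eq_zero_of_inner_right ℂ fun z => ?_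
    have := congrArg (fun f : AntiDual D => f z) hy2
    simpa [hy, adjointEmbedding_apply] using this.symm
  rw [bullet, Submodule.toLinearPMap_graph_eq _ key]
  rfl

/-- `A` maps its domain bijectively onto `H` and has a bounded everywhere defined inverse. -/
def HasBoundedInverse (A : H →ₗ.[ℂ] H) : Prop :=
  ∃ R : H →L[ℂ] H, (∀ h : H, (R h, h) ∈ A.graph) ∧ ∀ x : A.domain, R (A x) = x

/-- The dimension of `ker A`. -/
def kernelDim (A : H →ₗ.[ℂ] H) : ℕ∞ :=
  Cardinal.toENat (Module.rank ℂ (LinearMap.ker A.toFun))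

/-- The spectrum of the operator function `A` in the set `Δ`: those `μ ∈ Δ` for which `A μ` is not
boundedly invertible. -/
def spectrumIn (A : ℝ → H →ₗ.[ℂ] H) (Δ : Set ℝ) : Set ℝ :=
  {μ ∈ Δ | ¬ HasBoundedInverse (A μ)}

/-- The spectrum of `A` in `Δ` consists of isolated eigenvalues of finite multiplicity and has no
accumulation point in `Δ`. -/
def IsPurelyDiscreteIn (A : ℝ → H →ₗ.[ℂ] H) (Δ : Set ℝ) : Prop :=
  (∀ μ ∈ spectrumIn A Δ, kernelDim (A μ) ≠ 0 ∧ kernelDim (A μ) ≠ ⊤) ∧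
    ∀ μ ∈ Δ, ∀ᶠ l in 𝓝[≠] μ, l ∉ spectrumIn A Δ

/-- The total multiplicity of the spectrum of `A` in `Δ`: the (possibly infinite) sum of
`dim ker A μ` over all spectral points `μ ∈ Δ`. -/
def totalMultiplicity (A : ℝ → H →ₗ.[ℂ] H) (Δ : Set ℝ) : ℕ∞ :=
  ⨆ F : {F : Finset ℝ // (F : Set ℝ) ⊆ spectrumIn A Δ}, ∑ μ ∈ F.1, kernelDim (A μ)

/-- The negative index of inertia of the quadratic form `⟨A y, y⟩`: the supremum of the dimensions
of the subspaces on which the form is negative. -/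
def ind (A : D →L[ℂ] AntiDual D) : ℕ∞ :=
  ⨆ M : {M : Submodule ℂ D // ∀ y ∈ M, y ≠ 0 → (A y y).re < 0},
    Cardinal.toENat (Module.rank ℂ M.1)

/-- `⟨A y, y⟩ ≥ ε ‖y‖²` for some `ε > 0` and all `y`; in particular the form is real. -/
def IsUniformlyPositive (A : D →L[ℂ] AntiDual D) : Prop :=
  ∃ ε : ℝ, 0 < ε ∧ ∀ y : D, (A y y).im = 0 ∧ ε * ‖y‖ ^ 2 ≤ (A y y).re

/-- `A` is a compact perturbation of some uniformly positive operator. -/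
def IsCompactPerturbationOfUniformlyPositive (A : D →L[ℂ] AntiDual D) : Prop :=
  ∃ P K : D →L[ℂ] AntiDual D, IsUniformlyPositive P ∧ IsCompactOperator K ∧ A = P + K

/-- All eigenvalues of the operator function `T` in `Δ` are of negative type: for `μ ∈ Δ` and every
nonzero `y ∈ ker T(μ)` the function `λ ↦ ⟨T(λ) y, y⟩` has a strictly negative derivative at `μ`. -/
def EigenvaluesOfNegativeType (T : ℝ → D →L[ℂ] AntiDual D) (Δ : Set ℝ) : Prop :=
  ∀ μ ∈ Δ, ∀ y : D, T μ y = 0 → y ≠ 0 →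
    ∃ d : ℝ, d < 0 ∧ HasDerivAt (fun l : ℝ => (T l y y).re) d μ

/-- The compression `J* T J' : E' → E*` of `T : D → D*` by `J' : E' → D` and `J : E → D`. -/
def compress {E' : Type*} [NormedAddCommGroup E'] [InnerProductSpace ℂ E']
    (J : E →L[ℂ] D) (J' : E' →L[ℂ] D) (T : D →L[ℂ] AntiDual D) : E' →L[ℂ] AntiDual E :=
  (((T.comp J').flip).comp J).flip

theorem compress_apply {E' : Type*} [NormedAddCommGroup E'] [InnerProductSpace ℂ E']
    (J : E →L[ℂ] D) (J' : E' →L[ℂ] D) (T : D →L[ℂ] AntiDual D) (x : E') (y : E) :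
    compress J J' T x y = T (J' x) (J y) := rfl

end Operators

section Blocks

variable {D₁ D₂ H₁ H₂ : Type*}
  [NormedAddCommGroup D₁] [InnerProductSpace ℂ D₁]
  [NormedAddCommGroup D₂] [InnerProductSpace ℂ D₂]
  [NormedAddCommGroup H₁] [InnerProductSpace ℂ H₁]
  [NormedAddCommGroup H₂] [InnerProductSpace ℂ H₂]

/-- The inclusion of `D₁` in the orthogonal direct sum `D₁ ⊕ D₂`. -/
def incl₁ : D₁ →L[ℂ] WithLp 2 (D₁ × D₂) :=
  (WithLp.prodContinuousLinearEquiv 2 ℂ D₁ D₂).symm.toContinuousLinearMap.comp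
    (ContinuousLinearMap.inl ℂ D₁ D₂)

/-- The inclusion of `D₂` in the orthogonal direct sum `D₁ ⊕ D₂`. -/
def incl₂ : D₂ →L[ℂ] WithLp 2 (D₁ × D₂) :=
  (WithLp.prodContinuousLinearEquiv 2 ℂ D₁ D₂).symm.toContinuousLinearMap.comp
    (ContinuousLinearMap.inr ℂ D₁ D₂)

/-- `I = I₁ ⊕ I₂ : D₁ ⊕ D₂ → H₁ ⊕ H₂`. -/
def directSum (I₁ : D₁ →L[ℂ] H₁) (I₂ : D₂ →L[ℂ] H₂) :
    WithLp 2 (D₁ × D₂) →L[ℂ] WithLp 2 (H₁ × H₂) :=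
  (WithLp.prodContinuousLinearEquiv 2 ℂ H₁ H₂).symm.toContinuousLinearMap.comp
    ((I₁.prodMap I₂).comp
      (WithLp.prodContinuousLinearEquiv 2 ℂ D₁ D₂).toContinuousLinearMap)

theorem directSum_apply (I₁ : D₁ →L[ℂ] H₁) (I₂ : D₂ →L[ℂ] H₂) (x : WithLp 2 (D₁ × D₂)) :
    directSum I₁ I₂ x = WithLp.toLp 2 (I₁ x.fst, I₂ x.snd) := rfl

/-- The component `T₁₁ : D₁ → D₁*`. -/
def block₁₁ (T : WithLp 2 (D₁ × D₂) →L[ℂ] AntiDual (WithLp 2 (D₁ × D₂))) :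
    D₁ →L[ℂ] AntiDual D₁ := compress incl₁ incl₁ T

/-- The component `T₁₂ : D₂ → D₁*`. -/
def block₁₂ (T : WithLp 2 (D₁ × D₂) →L[ℂ] AntiDual (WithLp 2 (D₁ × D₂))) :
    D₂ →L[ℂ] AntiDual D₁ := compress incl₁ incl₂ T

/-- The component `T₂₁ : D₁ → D₂*`. -/
def block₂₁ (T : WithLp 2 (D₁ × D₂) →L[ℂ] AntiDual (WithLp 2 (D₁ × D₂))) :
    D₁ →L[ℂ] AntiDual D₂ := compress incl₂ incl₁ T

/-- The component `T₂₂ : D₂ → D₂*`. -/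
def block₂₂ (T : WithLp 2 (D₁ × D₂) →L[ℂ] AntiDual (WithLp 2 (D₁ × D₂))) :
    D₂ →L[ℂ] AntiDual D₂ := compress incl₂ incl₂ T

/-- The transfer operator `S = T₁₁ - T₁₂ T₂₂⁻¹ T₂₁ : D₁ → D₁*`, for `T₂₂` boundedly invertible. -/
def transfer (T : WithLp 2 (D₁ × D₂) →L[ℂ] AntiDual (WithLp 2 (D₁ × D₂))) :
    D₁ →L[ℂ] AntiDual D₁ :=
  block₁₁ T - (block₁₂ T).comp ((block₂₂ T).inverse.comp (block₂₁ T))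

end Blocks

end Rigged

end

open ComplexConjugate

noncomputable section

namespace Rigged

/-! ### Bounded invertibility and the Fredholm alternative. -/

section Invertible

variable {X Y : Type*} [NormedAddCommGroup X] [NormedSpace ℂ X] [CompleteSpace X]
  [NormedAddCommGroup Y] [NormedSpace ℂ Y]

/-! Since `T₂₂` is negative definite, completing the square writes the form of `T` at `(x, y)` as
the form of `S` at `x` plus a nonpositive term from `D₂`. Hence `T` and `S` have isomorphic kernels,
and `⟨S x, x⟩` is the maximum of the form of `T` over vectors with first component `x`
(`apply_schurLift_add_incl₂`, `re_apply_le_re_transfer`). This needs `T` to be a Hermitian form,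
which is recovered from self-adjointness of `T^•` by inverting a small imaginary shift of `T`
(`isHermitianForm_of_isSelfAdjoint_bullet`).

Fix `μ`. A compact perturbation of a uniformly positive operator splits `D₁ = M + ker S(μ) + U`,
with `M` finite-dimensional and negative, `U` uniformly positive (`exists_decomposition`). Lift
these spaces by the Schur map of `T(μ)`, kept fixed while `λ` varies. As `T` is Lipschitz in norm,
definiteness persists on the lift of `U` and on the lift of `M` plus `D₂`. On `ker T(μ)`, negative
type gives the form size at least `δ|λ - μ|`, positive on the left and negative on the right; its
coupling to the other spaces is `O(|λ - μ|)` and so costs only second order. The kernel therefore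
joins `U` on the left and `M` on the right: near `μ`, `T(λ)` is invertible off `μ`, and `ind S`
jumps by `dim ker T(μ)` just to the right of `μ` (`exists_ind_transfer_eventually`).

Compactness of the interval leaves finitely many jumps, and adding them gives the formula
(`exists_finset_eq_add_sum`). -/

theorem isInvertible_of_bijective [CompleteSpace Y] {A : X →L[ℂ] Y} (hA : Function.Bijective A) :
    A.IsInvertible :=
  ⟨ContinuousLinearEquiv.ofBijective A (LinearMap.ker_eq_bot.mpr hA.1)
    (LinearMap.range_eq_top.mpr hA.2), by ext; simp⟩

/-- The Fredholm alternative for a compact perturbation of an invertible operator. -/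
theorem isInvertible_add_of_isCompactOperator {Q K : X →L[ℂ] Y} (hQ : Q.IsInvertible)
    (hK : IsCompactOperator K) (hinj : Function.Injective (Q + K)) : (Q + K).IsInvertible := by
  obtain ⟨e, rfl⟩ := hQ
  let C : X →L[ℂ] X := e.symm.toContinuousLinearMap.comp K
  have hC : IsCompactOperator C := hK.clm_comp e.symm.toContinuousLinearMap
  have hdec : (e : X →L[ℂ] Y) + K = (e : X →L[ℂ] Y).comp (1 + C) := by ext x; simp [C]
  have hunit : IsUnit (1 + C) := by
    rcases hC.hasEigenvalue_or_mem_resolventSet (μ := -1) (by norm_num) with h | h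
    · obtain ⟨x, hx⟩ := h.exists_hasEigenvector
      exfalso
      apply hx.2
      apply hinj
      have hCx : C x = -x := by simpa using hx.apply_eq_smul
      rw [hdec]
      simp [hCx]
    · rw [spectrum.mem_resolventSet_iff] at h
      have : 1 + C = -(algebraMap ℂ (X →L[ℂ] X) (-1) - C) := by simp [add_comm]
      rw [this]
      exact h.neg
  rw [hdec]
  exact ContinuousLinearMap.isInvertible_equiv.comp
    (isInvertible_of_bijective (ContinuousLinearMap.isUnit_iff_bijective.mp hunit))

end Invertible

/-! ### Hermitian forms, coercivity and the negative index. -/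

section Forms

variable {D E : Type*}
  [NormedAddCommGroup D] [InnerProductSpace ℂ D]
  [NormedAddCommGroup E] [InnerProductSpace ℂ E]

/-- The sesquilinear form `⟨A x, y⟩` is Hermitian. -/
def IsHermitianForm (A : D →L[ℂ] AntiDual D) : Prop :=
  ∀ x y : D, A x y = conj (A y x)

/-- `⟨A x, x⟩ ≥ c ‖x‖²` on the subspace `U`, for some `c > 0`. -/
def CoerciveOn (A : D →L[ℂ] AntiDual D) (U : Submodule ℂ D) : Prop :=
  ∃ c : ℝ, 0 < c ∧ ∀ x ∈ U, c * ‖x‖ ^ 2 ≤ (A x x).re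

theorem IsHermitianForm.neg {A : D →L[ℂ] AntiDual D} (hA : IsHermitianForm A) :
    IsHermitianForm (-A) := fun x y => by
  simp [hA x y]

/-- Polarization: `x + y` settles the imaginary part and `x + i y` the real part. -/
theorem isHermitianForm_of_im_eq_zero {A : D →L[ℂ] AntiDual D} (h : ∀ x, (A x x).im = 0) :
    IsHermitianForm A := by
  intro x y
  have h1 := h (x + y)
  have h2 := h (x + Complex.I • y)
  simp only [map_add, map_smul, add_apply, smul_apply,
    ContinuousLinearMap.map_smulₛₗ, Complex.add_im, h x, h y, Complex.conj_I, smul_eq_mul,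
    Complex.mul_im, Complex.mul_re, Complex.I_re, Complex.I_im, Complex.neg_re, Complex.neg_im]
    at h1 h2
  apply Complex.ext
  · simp
    linarith
  · simp
    linarith

theorem norm_form_le (A : D →L[ℂ] AntiDual E) (x : D) (y : E) : ‖A x y‖ ≤ ‖A‖ * ‖x‖ * ‖y‖ :=
  ((A x).le_opNorm y).trans (by gcongr; exact A.le_opNorm x)

theorem CoerciveOn.mono {A : D →L[ℂ] AntiDual D} {U V : Submodule ℂ D} (h : CoerciveOn A V)
    (hUV : U ≤ V) : CoerciveOn A U :=
  let ⟨c, hc, h⟩ := h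
  ⟨c, hc, fun x hx => h x (hUV hx)⟩

theorem CoerciveOn.re_pos {A : D →L[ℂ] AntiDual D} {U : Submodule ℂ D} (h : CoerciveOn A U)
    {x : D} (hx : x ∈ U) (hx0 : x ≠ 0) : 0 < (A x x).re := by
  obtain ⟨c, hc, h⟩ := h
  have : 0 < ‖x‖ := norm_pos_iff.mpr hx0
  exact lt_of_lt_of_le (by positivity) (h x hx)

theorem CoerciveOn.re_nonneg {A : D →L[ℂ] AntiDual D} {U : Submodule ℂ D} (h : CoerciveOn A U)
    {x : D} (hx : x ∈ U) : 0 ≤ (A x x).re := by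
  obtain ⟨c, hc, h⟩ := h
  exact le_trans (by positivity) (h x hx)

theorem CoerciveOn.re_neg {A : D →L[ℂ] AntiDual D} {U : Submodule ℂ D} (h : CoerciveOn (-A) U)
    {x : D} (hx : x ∈ U) (hx0 : x ≠ 0) : (A x x).re < 0 := by
  simpa using h.re_pos hx hx0

/-- The form dominates the 2×2 matrix with diagonal `c`, `d` and off-diagonal `-e`, positive
definite because its determinant is. -/
theorem coerciveOn_sup {A : D →L[ℂ] AntiDual D} (hA : IsHermitianForm A) {U V : Submodule ℂ D}
    {c d e : ℝ} (hc : 0 < c) (hd : 0 < d) (hcd : e ^ 2 < c * d)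
    (hU : ∀ u ∈ U, c * ‖u‖ ^ 2 ≤ (A u u).re) (hV : ∀ v ∈ V, d * ‖v‖ ^ 2 ≤ (A v v).re)
    (hUV : ∀ u ∈ U, ∀ v ∈ V, ‖A u v‖ ≤ e * ‖u‖ * ‖v‖) : CoerciveOn A (U ⊔ V) := by
  -- Determinant over trace, a lower bound for the smaller eigenvalue.
  set δ := (c * d - e ^ 2) / (c + d) with hδ
  have hδ0 : 0 < δ := div_pos (by linarith) (by linarith)
  have hδ1 : δ * (c + d) = c * d - e ^ 2 := by rw [hδ]; field_simp
  have hcδ : 0 < c - δ := by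
    have : (c - δ) * (c + d) = c ^ 2 + e ^ 2 := by linear_combination -hδ1
    by_contra! hcon
    nlinarith
  refine ⟨δ / 2, by positivity, fun x hx => ?_⟩
  obtain ⟨u, hu, v, hv, rfl⟩ := Submodule.mem_sup.mp hx
  have h1 := hU u hu
  have h2 := hV v hv
  have h3 : -(e * ‖u‖ * ‖v‖) ≤ (A u v).re :=
    (neg_le_neg (hUV u hu v hv)).trans (abs_le.mp (Complex.abs_re_le_norm _)).1
  have h4 : (A v u).re = (A u v).re := by rw [hA v u, Complex.conj_re]
  have h5 : (A (u + v) (u + v)).re = (A u u).re + 2 * (A u v).re + (A v v).re := by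
    simp only [map_add, add_apply, Complex.add_re, h4]; ring
  have h6 : ‖u + v‖ ^ 2 ≤ 2 * (‖u‖ ^ 2 + ‖v‖ ^ 2) := by
    nlinarith [norm_add_le u v, norm_nonneg (u + v), sq_nonneg (‖u‖ - ‖v‖)]
  -- Completing the square, using `(c - δ)(d - δ) = e² + δ²`.
  have h7 : 0 ≤ (c - δ) * ((c - δ) * ‖u‖ ^ 2 - 2 * (e * ‖u‖ * ‖v‖) + (d - δ) * ‖v‖ ^ 2) := by
    have : (c - δ) * ((c - δ) * ‖u‖ ^ 2 - 2 * (e * ‖u‖ * ‖v‖) + (d - δ) * ‖v‖ ^ 2)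
      = ((c - δ) * ‖u‖ - e * ‖v‖) ^ 2 + δ ^ 2 * ‖v‖ ^ 2 := by
        linear_combination -‖v‖ ^ 2 * hδ1
    rw [this]; positivity
  have h8 := nonneg_of_mul_nonneg_right h7 hcδ
  rw [h5]
  nlinarith

theorem CoerciveOn.sup {A : D →L[ℂ] AntiDual D} (hA : IsHermitianForm A) {U V : Submodule ℂ D}
    (hU : CoerciveOn A U) (hV : CoerciveOn A V) (hUV : ∀ u ∈ U, ∀ v ∈ V, A u v = 0) :
    CoerciveOn A (U ⊔ V) := by
  obtain ⟨c, hc, hU⟩ := hU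
  obtain ⟨d, hd, hV⟩ := hV
  exact coerciveOn_sup (e := 0) hA hc hd (by simpa using mul_pos hc hd) hU hV
    fun u hu v hv => by simp [hUV u hu v hv]

theorem CoerciveOn.map {A : D →L[ℂ] AntiDual D} {B : E →L[ℂ] AntiDual E} {U : Submodule ℂ E}
    (h : CoerciveOn B U) (J : E →L[ℂ] D) (hJ : ∀ x ∈ U, A (J x) (J x) = B x x) :
    CoerciveOn A (U.map J.toLinearMap) := by
  obtain ⟨c, hc, h⟩ := h
  -- Only an upper bound on `J` is needed; the `+ 1` covers `J = 0`.
  refine ⟨c / (‖J‖ + 1) ^ 2, by positivity, ?_⟩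
  rintro _ ⟨x, hx, rfl⟩
  change _ * ‖J x‖ ^ 2 ≤ (A (J x) (J x)).re
  rw [hJ x hx]
  refine le_trans ?_ (h x hx)
  have : ‖J x‖ ≤ (‖J‖ + 1) * ‖x‖ := (J.le_opNorm x).trans (by gcongr; linarith)
  calc c / (‖J‖ + 1) ^ 2 * ‖J x‖ ^ 2 ≤ c / (‖J‖ + 1) ^ 2 * ((‖J‖ + 1) * ‖x‖) ^ 2 := by gcongr
    _ = c * ‖x‖ ^ 2 := by field_simp

theorem isHermitianForm_compress {A : D →L[ℂ] AntiDual D} (hA : IsHermitianForm A)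
    (J : E →L[ℂ] D) : IsHermitianForm (compress J J A) := fun x y => hA (J x) (J y)

/-! ### Riesz identification, invertibility criteria and compact forms. -/

section Riesz

variable [CompleteSpace D]

/-- The Riesz isomorphism of `D` onto its antidual. -/
def antiRiesz : D ≃L[ℂ] AntiDual D :=
  ContinuousLinearEquiv.ofBijective (adjointEmbedding (ContinuousLinearMap.id ℂ D))
    (LinearMap.ker_eq_bot.mpr <| (injective_iff_map_eq_zero _).mpr fun x hx => by
      have := congrArg (fun f : AntiDual D => f x) hx
      simpa [adjointEmbedding_apply] using this)
    (LinearMap.range_eq_top.mpr fun f => by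
      let g : StrongDual ℂ D := ((starL ℂ : ℂ ≃L⋆[ℂ] ℂ) : ℂ →L⋆[ℂ] ℂ).comp f
      refine ⟨(InnerProductSpace.toDual ℂ D).symm g, ?_⟩
      ext y
      change inner ℂ y ((InnerProductSpace.toDual ℂ D).symm g) = f y
      rw [← inner_conj_symm, InnerProductSpace.toDual_symm_apply]
      simp [g])

theorem antiRiesz_apply (x y : D) : antiRiesz x y = inner ℂ y x := rfl

theorem inner_antiRiesz_symm (f : AntiDual D) (y : D) : inner ℂ y (antiRiesz.symm f) = f y := by
  rw [← antiRiesz_apply, ContinuousLinearEquiv.apply_symm_apply]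

/-- The lower bound makes the range closed and the kernel zero; by symmetry the orthogonal
complement of the range, after Riesz, is the kernel. -/
theorem IsHermitianForm.isInvertible_of_bound {A : D →L[ℂ] AntiDual D} (hA : IsHermitianForm A)
    {c : ℝ} (hc : 0 < c) (h : ∀ x, c * ‖x‖ ≤ ‖A x‖) : A.IsInvertible := by
  let B : D →L[ℂ] D := (antiRiesz (D := D)).symm.toContinuousLinearMap.comp A
  have hB : ∀ x y, inner ℂ y (B x) = A x y := fun x y => inner_antiRiesz_symm _ _
  have hBA : ∀ x, ‖A x‖ ≤ ‖(antiRiesz (D := D)).toContinuousLinearMap‖ * ‖B x‖ := fun x => by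
    have : A x = (antiRiesz (D := D)).toContinuousLinearMap (B x) := by simp [B]
    rw [this]
    exact ContinuousLinearMap.le_opNorm _ _
  set r := ‖(antiRiesz (D := D)).toContinuousLinearMap‖ with hr
  have hr0 : 0 ≤ r := by rw [hr]; exact norm_nonneg (antiRiesz (D := D)).toContinuousLinearMap
  have hbij : Function.Bijective B := by
    rw [ContinuousLinearMap.bijective_iff_dense_range_and_antilipschitz]
    constructor
    · rw [Submodule.topologicalClosure_eq_top_iff, Submodule.eq_bot_iff]
      intro y hy
      have h0 : A y = 0 := by
        ext x
        have := hy (B x) ⟨x, rfl⟩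
        rw [← inner_conj_symm, hB, ← hA y x] at this
        simpa using this
      have := h y
      rw [h0, norm_zero] at this
      exact norm_eq_zero.mp (le_antisymm (nonpos_of_mul_nonpos_right this hc) (norm_nonneg _))
    · refine ⟨⟨r / c, by positivity⟩, B.antilipschitz_of_bound fun x => ?_⟩
      have := (h x).trans (hBA x)
      change ‖x‖ ≤ r / c * ‖B x‖
      rw [div_mul_eq_mul_div, le_div_iff₀ hc]
      linarith
  have : A = (antiRiesz (D := D)).toContinuousLinearMap.comp B := by ext x; simp [B]
  rw [this]
  exact (ContinuousLinearMap.isInvertible_equiv).comp (isInvertible_of_bijective hbij)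

/-- Test `A (u + v)` against `u - v`: the real parts of the cross terms cancel, so `U` and `V` need
not be orthogonal in any sense. -/
theorem IsHermitianForm.isInvertible_of_coerciveOn {A : D →L[ℂ] AntiDual D}
    (hA : IsHermitianForm A) {U V : Submodule ℂ D} (hU : CoerciveOn A U)
    (hV : CoerciveOn (-A) V) (hUV : U ⊔ V = ⊤) : A.IsInvertible := by
  obtain ⟨c, hc, hU⟩ := hU
  obtain ⟨d, hd, hV⟩ := hV
  set δ := min c d with hδ
  have hδ0 : 0 < δ := lt_min hc hd
  refine hA.isInvertible_of_bound (c := δ / 2) (by positivity) fun x => ?_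
  obtain ⟨u, hu, v, hv, rfl⟩ := Submodule.mem_sup.mp (hUV ▸ Submodule.mem_top : x ∈ U ⊔ V)
  have h1 : δ * ‖u‖ ^ 2 ≤ (A u u).re :=
    le_trans (mul_le_mul_of_nonneg_right (min_le_left _ _) (by positivity)) (hU u hu)
  have h2 : δ * ‖v‖ ^ 2 ≤ -(A v v).re :=
    le_trans (mul_le_mul_of_nonneg_right (min_le_right _ _) (by positivity))
      (by simpa using hV v hv)
  have h3 : (A (u + v) (u - v)).re = (A u u).re - (A v v).re := by
    have : (A v u).re = (A u v).re := by rw [hA v u, Complex.conj_re]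
    simp only [map_add, map_sub, add_apply, Complex.add_re, Complex.sub_re, this]
    ring
  have h4 : (A (u + v) (u - v)).re ≤ ‖A (u + v)‖ * (‖u‖ + ‖v‖) :=
    (Complex.re_le_norm _).trans (((A (u + v)).le_opNorm _).trans
      (by gcongr; exact norm_sub_le _ _))
  have h5 := norm_add_le u v
  by_cases h0 : ‖u‖ + ‖v‖ = 0
  · have : ‖u + v‖ = 0 := le_antisymm (by linarith) (norm_nonneg _)
    rw [this, mul_zero]
    exact norm_nonneg _
  have h6 : 0 < ‖u‖ + ‖v‖ := lt_of_le_of_ne (by positivity) (Ne.symm h0)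
  have h7 : δ / 2 * (‖u‖ + ‖v‖) * (‖u‖ + ‖v‖) ≤ ‖A (u + v)‖ * (‖u‖ + ‖v‖) := by
    nlinarith [sq_nonneg (‖u‖ - ‖v‖)]
  exact le_trans (by gcongr) (le_of_mul_le_mul_right h7 h6)

/-- Take `F` to be the span of a finite `ε`-net for the image of the unit ball; vectors orthogonal
to `F` see only the error of the net. -/
theorem exists_norm_form_le_of_isCompactOperator {K : D →L[ℂ] AntiDual D}
    (hK : IsCompactOperator K) {ε : ℝ} (hε : 0 < ε) :
    ∃ F : Submodule ℂ D, FiniteDimensional ℂ F ∧ ∀ y ∈ Fᗮ, ‖K y y‖ ≤ ε * ‖y‖ ^ 2 := by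
  let C : D →L[ℂ] D := (antiRiesz (D := D)).symm.toContinuousLinearMap.comp K
  have hC : IsCompactOperator C := hK.clm_comp (antiRiesz (D := D)).symm.toContinuousLinearMap
  have hCK : ∀ x y, inner ℂ y (C x) = K x y := fun x y => inner_antiRiesz_symm _ _
  have htb : TotallyBounded (closure (C '' Metric.closedBall 0 1)) :=
    (hC.isCompact_closure_image_closedBall (f := C.toLinearMap) 1).totallyBounded
  obtain ⟨t, ht, hcov⟩ := Metric.totallyBounded_iff.mp htb ε hε
  refine ⟨Submodule.span ℂ t, FiniteDimensional.span_of_finite ℂ ht, fun y hy => ?_⟩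
  by_cases hy0 : y = 0
  · simp [hy0]
  have hn : 0 < ‖y‖ := norm_pos_iff.mpr hy0
  have hmem : C (((‖y‖⁻¹ : ℝ) : ℂ) • y) ∈ closure (C '' Metric.closedBall 0 1) :=
    subset_closure ⟨_, by simp [norm_smul, hn.ne'], rfl⟩
  obtain ⟨w, hw, hdist⟩ := Set.mem_iUnion₂.mp (hcov hmem)
  have horth : inner ℂ y (((‖y‖ : ℝ) : ℂ) • w) = 0 := by
    rw [inner_smul_right, Submodule.inner_left_of_mem_orthogonal (Submodule.subset_span hw) hy,
      mul_zero]
  have hCy : C y = ((‖y‖ : ℝ) : ℂ) • C (((‖y‖⁻¹ : ℝ) : ℂ) • y) := by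
    rw [map_smul, smul_smul, ← Complex.ofReal_mul, mul_inv_cancel₀ hn.ne', Complex.ofReal_one,
      one_smul]
  have hdist' : ‖C (((‖y‖⁻¹ : ℝ) : ℂ) • y) - w‖ ≤ ε := by
    rw [← dist_eq_norm]; exact (Metric.mem_ball.mp hdist).le
  have : K y y = inner ℂ y (((‖y‖ : ℝ) : ℂ) • (C (((‖y‖⁻¹ : ℝ) : ℂ) • y) - w)) := by
    rw [smul_sub, inner_sub_right, horth, sub_zero, ← hCy, hCK]
  rw [this]
  refine (norm_inner_le_norm _ _).trans ?_
  rw [norm_smul, Complex.norm_real, norm_norm]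
  nlinarith [mul_le_mul_of_nonneg_left hdist' (mul_nonneg hn.le hn.le)]

end Riesz

/-- The negative index of a form that is negative definite on a finite-dimensional subspace and
nonnegative on a complement of it. -/
theorem ind_eq_finrank {A : D →L[ℂ] AntiDual D} {M Z : Submodule ℂ D} [FiniteDimensional ℂ M]
    (hM : ∀ y ∈ M, y ≠ 0 → (A y y).re < 0) (hZ : ∀ y ∈ Z, 0 ≤ (A y y).re) (hMZ : M ⊔ Z = ⊤) :
    ind A = (Module.finrank ℂ M : ℕ∞) := by
  have hMr : Cardinal.toENat (Module.rank ℂ M) = (Module.finrank ℂ M : ℕ∞) := by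
    rw [← Module.finrank_eq_rank, Cardinal.toENat_nat]
  apply le_antisymm
  · refine iSup_le fun ⟨M', hM'⟩ => ?_
    rw [← hMr]
    refine Cardinal.toENat.monotone' ?_
    -- `M'` meets `Z` only in zero, so it embeds in `D ⧸ Z`, which is covered by `M`.
    have h1 : Module.rank ℂ M' ≤ Module.rank ℂ (D ⧸ Z) := by
      refine LinearMap.rank_le_of_injective (Z.mkQ.comp M'.subtype) ?_
      refine (injective_iff_map_eq_zero _).mpr fun x hx => ?_
      have hxZ : (x : D) ∈ Z := by simpa using hx
      by_contra hx0
      exact absurd (hM' x x.2 (by simpa using hx0)) (not_lt.mpr (hZ x hxZ))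
    refine h1.trans (LinearMap.rank_le_of_surjective (Z.mkQ.comp M.subtype) ?_)
    intro q
    obtain ⟨x, rfl⟩ := Z.mkQ_surjective q
    obtain ⟨m, hm, z, hz, rfl⟩ := Submodule.mem_sup.mp (hMZ ▸ Submodule.mem_top : x ∈ M ⊔ Z)
    refine ⟨⟨m, hm⟩, ?_⟩
    simpa [Submodule.Quotient.mk_eq_zero] using hz
  · rw [← hMr]
    exact le_iSup (fun M : {M : Submodule ℂ D // ∀ y ∈ M, y ≠ 0 → (A y y).re < 0} =>
      Cardinal.toENat (Module.rank ℂ M.1)) ⟨M, hM⟩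

end Forms


/-! ### Splitting into negative, null and coercive subspaces. -/

section Decomposition

variable {D : Type*} [NormedAddCommGroup D] [InnerProductSpace ℂ D]

theorem coerciveOn_bot (A : D →L[ℂ] AntiDual D) : CoerciveOn A ⊥ :=
  ⟨1, one_pos, fun x hx => by simp [(Submodule.mem_bot ℂ).mp hx]⟩

theorem exists_pos_forall_le_of_pos {ι : Type*} [Finite ι] (f : ι → ℝ) :
    ∃ c : ℝ, 0 < c ∧ ∀ i, 0 < f i → c ≤ f i := by
  have h : ∀ᶠ c : ℝ in 𝓝[>] 0, ∀ i, 0 < f i → c ≤ f i := by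
    rw [Filter.eventually_all]
    intro i
    by_cases hi : 0 < f i
    · filter_upwards [Ioc_mem_nhdsGT hi] with c hc _ using hc.2
    · simp [hi]
  obtain ⟨c, hc, hc0⟩ := (h.and self_mem_nhdsWithin).exists
  exact ⟨c, hc0, hc⟩

/-- Diagonalize the symmetric operator representing the form and sort its eigenvectors by the sign
of the eigenvalue. -/
theorem exists_decomposition_of_finiteDimensional [FiniteDimensional ℂ D]
    {A : D →L[ℂ] AntiDual D} (hA : IsHermitianForm A) :
    ∃ M U : Submodule ℂ D, CoerciveOn A U ∧ CoerciveOn (-A) M ∧ M ⊔ A.ker ⊔ U = ⊤ := by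
  have : CompleteSpace D := FiniteDimensional.complete ℂ D
  let T : D →ₗ[ℂ] D := ((antiRiesz (D := D)).symm.toContinuousLinearMap.comp A).toLinearMap
  have hTA : ∀ x y, inner ℂ y (T x) = A x y := fun x y => inner_antiRiesz_symm _ _
  have hT : T.IsSymmetric := fun x y => by
    rw [← inner_conj_symm, hTA, hTA, ← hA y x]
  let b := hT.eigenvectorBasis rfl
  let ev := hT.eigenvalues rfl
  have hform : ∀ x, (A x x).re = ∑ i, ev i * ‖b.repr x i‖ ^ 2 := fun x => by
    rw [← hTA, ← b.repr.inner_map_map, PiLp.inner_apply, Complex.re_sum]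
    refine Finset.sum_congr rfl fun i _ => ?_
    rw [hT.eigenvectorBasis_apply_self_apply rfl x i]
    change (((ev i : ℝ) : ℂ) * b.repr x i * conj (b.repr x i)).re = _
    rw [mul_assoc, Complex.mul_conj, ← Complex.ofReal_mul, Complex.ofReal_re,
      Complex.normSq_eq_norm_sq]
  have hnorm : ∀ x : D, ‖x‖ ^ 2 = ∑ i, ‖b.repr x i‖ ^ 2 := fun x => by
    rw [← b.repr.norm_map, EuclideanSpace.norm_sq_eq]
  let S (p : ℝ → Prop) : Submodule ℂ D :=
    { carrier := {x | ∀ i, ¬ p (ev i) → b.repr x i = 0}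
      zero_mem' := fun i _ => by simp
      add_mem' := fun hx hy i hi => by simp [hx i hi, hy i hi]
      smul_mem' := fun c x hx i hi => by simp [hx i hi] }
  have hmem : ∀ p i, p (ev i) → b i ∈ S p := fun p i hi j hj => by
    have : j ≠ i := fun h => hj (h ▸ hi)
    simp [b.repr_self, this]
  refine ⟨S (· < 0), S (0 < ·), ?_, ?_, ?_⟩
  · obtain ⟨c, hc, h⟩ := exists_pos_forall_le_of_pos ev
    refine ⟨c, hc, fun x hx => ?_⟩
    rw [hform, hnorm, Finset.mul_sum]
    refine Finset.sum_le_sum fun i _ => ?_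
    by_cases hi : 0 < ev i
    · exact mul_le_mul_of_nonneg_right (h i hi) (by positivity)
    · simp [hx i hi]
  · obtain ⟨c, hc, h⟩ := exists_pos_forall_le_of_pos (fun i => - ev i)
    refine ⟨c, hc, fun x hx => ?_⟩
    rw [neg_apply, neg_apply, Complex.neg_re, hform, hnorm, Finset.mul_sum,
      ← Finset.sum_neg_distrib]
    refine Finset.sum_le_sum fun i _ => ?_
    by_cases hi : ev i < 0
    · rw [← neg_mul]
      exact mul_le_mul_of_nonneg_right (h i (neg_pos.mpr hi)) (by positivity)
    · simp [hx i hi]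
  · rw [eq_top_iff, ← b.toBasis.span_eq, Submodule.span_le]
    rintro _ ⟨i, rfl⟩
    rw [OrthonormalBasis.coe_toBasis]
    rcases lt_trichotomy (ev i) 0 with hi | hi | hi
    · exact Submodule.mem_sup_left (Submodule.mem_sup_left (hmem (· < 0) i hi))
    · refine Submodule.mem_sup_left (Submodule.mem_sup_right ?_)
      have h1 : T (b i) = 0 := by
        rw [hT.apply_eigenvectorBasis rfl i]
        change ((ev i : ℝ) : ℂ) • b i = 0
        rw [hi]; simp
      rw [LinearMap.mem_ker]
      change A (b i) = 0
      ext y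
      rw [← hTA, h1]; simp
    · exact Submodule.mem_sup_right (hmem (0 < ·) i hi)

variable [CompleteSpace D]

/-- A Hermitian form that is coercive on a closed subspace of finite codimension splits the space
into a finite-dimensional negative subspace, its finite-dimensional kernel and a coercive
subspace. -/
theorem exists_decomposition_of_coerciveOn {S : D →L[ℂ] AntiDual D} (hS : IsHermitianForm S)
    {F G : Submodule ℂ D} [FiniteDimensional ℂ F] (hG : CoerciveOn S G)
    (hGc : IsClosed (G : Set D)) (hFG : F ⊔ G = ⊤) :
    ∃ M U : Submodule ℂ D, FiniteDimensional ℂ M ∧ FiniteDimensional ℂ S.ker ∧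
      CoerciveOn S U ∧ CoerciveOn (-S) M ∧ M ⊔ S.ker ⊔ U = ⊤ := by
  have : CompleteSpace G := hGc.completeSpace_coe
  have hinv : (compress G.subtypeL G.subtypeL S).IsInvertible := by
    obtain ⟨c, hc, hG⟩ := hG
    exact (isHermitianForm_compress hS _).isInvertible_of_coerciveOn (U := ⊤)
      ⟨c, hc, fun x _ => hG x x.2⟩ (coerciveOn_bot _) (by simp)
  -- `R` is the `S`-orthogonal complement of `G`. Invertibility of `S` on `G` gives `G + R = D`;
  -- coercivity gives `G ∩ R = 0`, so `R` is finite-dimensional and carries all the remaining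
  -- signature.
  let R : Submodule ℂ D := (compress G.subtypeL (ContinuousLinearMap.id ℂ D) S).ker
  have hR : ∀ x, x ∈ R ↔ ∀ g ∈ G, S x g = 0 := fun x => by
    refine ⟨fun h g hg => congrArg (fun f : AntiDual G => f ⟨g, hg⟩) h, fun h => ?_⟩
    refine LinearMap.mem_ker.mpr ?_
    ext g
    exact h g g.2
  have hGR : G ⊔ R = ⊤ := by
    refine eq_top_iff.mpr fun x _ => ?_
    obtain ⟨g, hg⟩ := hinv.surjective (compress G.subtypeL (ContinuousLinearMap.id ℂ D) S x)
    refine Submodule.mem_sup.mpr ⟨g, g.2, x - g, (hR _).mpr fun k hk => ?_, by abel⟩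
    have := congrArg (fun f : AntiDual G => f ⟨k, hk⟩) hg
    have h1 : S g k = S x k := this
    rw [map_sub, sub_apply, h1, sub_self]
  have hRfin : FiniteDimensional ℂ R := by
    have hq : Module.Finite ℂ (D ⧸ G) := by
      refine Module.Finite.of_surjective (G.mkQ.comp F.subtype) fun q => ?_
      obtain ⟨x, rfl⟩ := G.mkQ_surjective q
      obtain ⟨f, hf, g, hg, rfl⟩ := Submodule.mem_sup.mp (hFG ▸ Submodule.mem_top : x ∈ F ⊔ G)
      refine ⟨⟨f, hf⟩, ?_⟩
      simpa [Submodule.Quotient.mk_eq_zero] using hg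
    refine Module.Finite.of_injective (G.mkQ.comp R.subtype) ?_
    refine (injective_iff_map_eq_zero _).mpr fun x hx => ?_
    have hxG : (x : D) ∈ G := by simpa using hx
    by_contra hx0
    exact (hG.re_pos hxG (by simpa using hx0)).ne' (by simp [(hR x).mp x.2 x hxG])
  have hker : S.ker ≤ R := fun x hx => (hR x).mpr fun g _ => by
    have : S x = 0 := hx
    simp [this]
  obtain ⟨M, U, hU, hM, htop⟩ :=
    exists_decomposition_of_finiteDimensional (isHermitianForm_compress hS R.subtypeL)
  refine ⟨M.map R.subtype, U.map R.subtype ⊔ G, inferInstance,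
    Submodule.finiteDimensional_of_le hker, ?_, ?_, ?_⟩
  · refine (hU.map (A := S) R.subtypeL fun x _ => rfl).sup hS hG ?_
    rintro _ ⟨x, _, rfl⟩ g hg
    exact (hR x).mp x.2 g hg
  · exact hM.map (A := -S) R.subtypeL fun x _ => rfl
  · have hk : ((compress R.subtypeL R.subtypeL S).ker).map R.subtype ≤ S.ker := by
      rintro _ ⟨x, hx, rfl⟩
      refine LinearMap.mem_ker.mpr ?_
      change S x = 0
      ext y
      obtain ⟨g, hg, r, hr, rfl⟩ := Submodule.mem_sup.mp (hGR ▸ Submodule.mem_top : y ∈ G ⊔ R)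
      have h1 : S x r = 0 := congrArg (fun f : AntiDual R => f ⟨r, hr⟩) hx
      simp [(hR x).mp x.2 g hg, h1]
    have h2 := congrArg (Submodule.map R.subtype) htop
    rw [Submodule.map_sup, Submodule.map_sup, Submodule.map_top, Submodule.range_subtype] at h2
    rw [← sup_assoc, eq_top_iff, ← hGR, sup_comm G R]
    refine sup_le_sup_right ?_ G
    refine h2.ge.trans ?_
    exact sup_le_sup_right (sup_le_sup_left hk _) _

/-- Off a finite-dimensional space the compact part uses up at most half of the positivity constant.
-/
theorem exists_decomposition {S : D →L[ℂ] AntiDual D} (hS : IsHermitianForm S)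
    (h : IsCompactPerturbationOfUniformlyPositive S) :
    ∃ M U : Submodule ℂ D, FiniteDimensional ℂ M ∧ FiniteDimensional ℂ S.ker ∧
      CoerciveOn S U ∧ CoerciveOn (-S) M ∧ M ⊔ S.ker ⊔ U = ⊤ := by
  obtain ⟨P, K, ⟨ε, hε, hP⟩, hK, rfl⟩ := h
  obtain ⟨F, hF, hFK⟩ := exists_norm_form_le_of_isCompactOperator hK (half_pos hε)
  refine exists_decomposition_of_coerciveOn hS (F := F) (G := Fᗮ) ⟨ε / 2, half_pos hε, ?_⟩
    F.isClosed_orthogonal Submodule.sup_orthogonal_of_hasOrthogonalProjection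
  intro x hx
  have h1 := (abs_le.mp ((Complex.abs_re_le_norm _).trans (hFK x hx))).1
  have h2 := (hP x).2
  simp only [add_apply, Complex.add_re]
  linarith

end Decomposition


/-! ### From self-adjointness of `T^•` to symmetry of the form of `T`. -/

theorem exists_pos_isInvertible_sub {X Y : Type*} [NormedAddCommGroup X] [NormedSpace ℂ X]
    [CompleteSpace X] [NormedAddCommGroup Y] [NormedSpace ℂ Y] {Q : X →L[ℂ] Y}
    (hQ : Q.IsInvertible) (W : X →L[ℂ] Y) :
    ∃ ε : ℝ, 0 < ε ∧ (Q - (ε * Complex.I) • W).IsInvertible := by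
  obtain ⟨e, rfl⟩ := hQ
  have hcont : Continuous fun ε : ℝ => (e : X →L[ℂ] Y) - (ε * Complex.I) • W := by
    fun_prop
  have h0 := hcont.tendsto 0
  simp only [Complex.ofReal_zero, zero_mul, zero_smul, sub_zero] at h0
  obtain ⟨ε, hε, hε0⟩ := (((h0.eventually (ContinuousLinearEquiv.nhds e)).filter_mono
    nhdsWithin_le_nhds).and (self_mem_nhdsWithin (s := Ioi (0 : ℝ)))).exists
  exact ⟨ε, hε0, hε⟩

section SelfAdjoint

variable {D H : Type*}
  [NormedAddCommGroup D] [InnerProductSpace ℂ D]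
  [NormedAddCommGroup H] [InnerProductSpace ℂ H] [CompleteSpace H]

theorem inner_eq_inner_of_isSelfAdjoint_bullet {I : D →L[ℂ] H} (hI : Function.Injective I)
    (hd : DenseRange I) {T : D →L[ℂ] AntiDual D} (hsa : IsSelfAdjoint (bullet I T)) {y z : D}
    {h k : H} (hy : T y = adjointEmbedding I h) (hz : T z = adjointEmbedding I k) :
    inner ℂ h (I z) = inner ℂ (I y) k := by
  have hform := LinearPMap.adjoint_isFormalAdjoint hsa.dense_domain
  rw [LinearPMap.isSelfAdjoint_def.mp hsa] at hform
  obtain ⟨u, hu, hu'⟩ := (LinearPMap.mem_graph_iff _).mp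
    ((mem_bullet_graph_iff I hI hd T (I y) h).mpr ⟨y, rfl, hy⟩)
  obtain ⟨v, hv, hv'⟩ := (LinearPMap.mem_graph_iff _).mp
    ((mem_bullet_graph_iff I hI hd T (I z) k).mpr ⟨z, rfl, hz⟩)
  simpa [hu, hu', hv, hv'] using hform u v

/-- A nonzero kernel vector `y` would make `I y` an eigenvector of the symmetric operator `T^•` with
eigenvalue `iε`. -/
theorem injective_sub_of_isSelfAdjoint_bullet {I : D →L[ℂ] H} (hI : Function.Injective I)
    (hd : DenseRange I) {T : D →L[ℂ] AntiDual D} (hsa : IsSelfAdjoint (bullet I T)) {ε : ℝ}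
    (hε : 0 < ε) :
    Function.Injective (T - (ε * Complex.I) • (adjointEmbedding I).comp I) := by
  refine (injective_iff_map_eq_zero _).mpr fun y hy => ?_
  have h1 : T y = adjointEmbedding I ((ε * Complex.I) • I y) := by
    rw [sub_apply, sub_eq_zero] at hy
    rw [hy, map_smul]
    rfl
  have h2 := inner_eq_inner_of_isSelfAdjoint_bullet hI hd hsa h1 h1
  rw [inner_smul_left, inner_smul_right, inner_self_eq_norm_sq_to_K] at h2
  have h3 := congrArg Complex.im h2
  simp [← Complex.ofReal_pow] at h3
  have h4 : ε * ‖I y‖ ^ 2 = 0 := by linarith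
  have h5 : I y = 0 := by simpa [hε.ne'] using h4
  exact hI (by rw [h5, map_zero])

variable [CompleteSpace D]

/-- Up to Riesz this is the Hilbert adjoint of `I`, and the orthogonal complement of its range is
`ker I`. -/
theorem denseRange_adjointEmbedding {I : D →L[ℂ] H} (hI : Function.Injective I) :
    DenseRange (adjointEmbedding I) := by
  have h1 : DenseRange (ContinuousLinearMap.adjoint I) := by
    have : (ContinuousLinearMap.adjoint I).range.topologicalClosure = ⊤ := by
      rw [Submodule.topologicalClosure_eq_top_iff, ContinuousLinearMap.orthogonal_range,
        ContinuousLinearMap.adjoint_adjoint]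
      exact LinearMap.ker_eq_bot.mpr hI
    exact Submodule.dense_iff_topologicalClosure_eq_top.mpr this
  have h2 : (adjointEmbedding I : H → AntiDual D) = antiRiesz ∘ ContinuousLinearMap.adjoint I := by
    ext h y
    rw [adjointEmbedding_apply, Function.comp_apply, antiRiesz_apply,
      ContinuousLinearMap.adjoint_inner_right]
  rw [h2]
  exact antiRiesz.surjective.denseRange.comp h1 antiRiesz.continuous

/-- The inverse carries the dense range of `I*` to a dense set of vectors `y` with `I y` in the
domain of `T^•`. Symmetry holds there and extends by joint continuity. -/
theorem isHermitianForm_of_isInvertible_sub {I : D →L[ℂ] H} (hI : Function.Injective I)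
    (hd : DenseRange I) {T : D →L[ℂ] AntiDual D} (hsa : IsSelfAdjoint (bullet I T)) {a : ℂ}
    (hinv : (T - a • (adjointEmbedding I).comp I).IsInvertible) : IsHermitianForm T := by
  obtain ⟨e, he⟩ := hinv
  have hdense : DenseRange fun h : H => e.symm (adjointEmbedding I h) :=
    e.symm.surjective.denseRange.comp (denseRange_adjointEmbedding hI) e.symm.continuous
  have hT : ∀ h : H, T (e.symm (adjointEmbedding I h)) =
      adjointEmbedding I (h + a • I (e.symm (adjointEmbedding I h))) := fun h => by
    have h1 : (e : D →L[ℂ] AntiDual D) (e.symm (adjointEmbedding I h)) = adjointEmbedding I h :=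
      e.apply_symm_apply _
    rw [he, sub_apply, sub_eq_iff_eq_add] at h1
    rw [h1, map_add, map_smul]
    rfl
  have hcont : Continuous fun q : D × D => T q.1 q.2 := by
    have h1 : Continuous fun x => antiRiesz.symm (T x) := antiRiesz.symm.continuous.comp T.continuous
    simp only [← inner_antiRiesz_symm (T _)]
    exact continuous_snd.inner (h1.comp continuous_fst)
  refine isClosed_property2 (p := fun x y => T x y = conj (T y x)) hdense ?_ ?_
  · exact isClosed_eq hcont (Complex.continuous_conj.comp (hcont.comp continuous_swap))
  · intro h k
    rw [hT h, hT k, adjointEmbedding_apply, adjointEmbedding_apply, inner_conj_symm]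
    exact (inner_eq_inner_of_isSelfAdjoint_bullet hI hd hsa (hT k) (hT h)).symm

/-- A small shift by `iε I* I` keeps `Q` invertible, and symmetry of `T^•` makes the shifted `T`
injective; the Fredholm alternative then makes it invertible. -/
theorem isHermitianForm_of_isSelfAdjoint_bullet {I : D →L[ℂ] H} (hI : Function.Injective I)
    (hd : DenseRange I) {T Q K : D →L[ℂ] AntiDual D} (hsa : IsSelfAdjoint (bullet I T))
    (hQ : Q.IsInvertible) (hK : IsCompactOperator K) (hT : T = Q + K) : IsHermitianForm T := by
  obtain ⟨ε, hε, hinv⟩ := exists_pos_isInvertible_sub hQ ((adjointEmbedding I).comp I)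
  have hinj := injective_sub_of_isSelfAdjoint_bullet hI hd hsa hε
  refine isHermitianForm_of_isInvertible_sub hI hd hsa (a := ε * Complex.I) ?_
  have h : T - (ε * Complex.I) • (adjointEmbedding I).comp I =
      Q - (ε * Complex.I) • (adjointEmbedding I).comp I + K := by
    rw [hT]
    ext x y
    simp only [sub_apply, add_apply]
    ring
  rw [h] at hinj ⊢
  exact isInvertible_add_of_isCompactOperator hinv hK hinj

end SelfAdjoint

/-! ### Schur complement: relating `T` to its transfer operator. -/

section Blocks

variable {D₁ D₂ : Type*}
  [NormedAddCommGroup D₁] [InnerProductSpace ℂ D₁]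
  [NormedAddCommGroup D₂] [InnerProductSpace ℂ D₂]

/-- The projection of `D₁ ⊕ D₂` onto `D₁`. -/
def proj₁ : WithLp 2 (D₁ × D₂) →L[ℂ] D₁ :=
  (ContinuousLinearMap.fst ℂ D₁ D₂).comp
    (WithLp.prodContinuousLinearEquiv 2 ℂ D₁ D₂).toContinuousLinearMap

theorem proj₁_incl₁ (x : D₁) : proj₁ (incl₁ x : WithLp 2 (D₁ × D₂)) = x := rfl

theorem proj₁_incl₂ (y : D₂) : proj₁ (incl₂ y : WithLp 2 (D₁ × D₂)) = 0 := rfl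

theorem exists_eq_incl₁_add_incl₂ (d : WithLp 2 (D₁ × D₂)) :
    ∃ x y, d = incl₁ x + incl₂ y := by
  refine ⟨d.fst, d.snd, ?_⟩
  have : d = WithLp.toLp 2 (d.fst, d.snd) := rfl
  rw [this]
  change _ = WithLp.toLp 2 (d.fst, 0) + WithLp.toLp 2 (0, d.snd)
  rw [← WithLp.toLp_add]
  simp

/-- The map `x ↦ (x, -T₂₂⁻¹ T₂₁ x)`, whose composition with `T` has vanishing second component. -/
def schurLift (T : WithLp 2 (D₁ × D₂) →L[ℂ] AntiDual (WithLp 2 (D₁ × D₂))) :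
    D₁ →L[ℂ] WithLp 2 (D₁ × D₂) :=
  incl₁ - incl₂.comp ((block₂₂ T).inverse.comp (block₂₁ T))

variable {T : WithLp 2 (D₁ × D₂) →L[ℂ] AntiDual (WithLp 2 (D₁ × D₂))}

theorem schurLift_apply (x : D₁) :
    schurLift T x = incl₁ x - incl₂ ((block₂₂ T).inverse (block₂₁ T x)) := rfl

theorem incl₁_eq_schurLift_add (x : D₁) :
    incl₁ x = schurLift T x + incl₂ ((block₂₂ T).inverse (block₂₁ T x)) := by
  rw [schurLift_apply]; abel

theorem exists_eq_schurLift_add_incl₂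
    (T : WithLp 2 (D₁ × D₂) →L[ℂ] AntiDual (WithLp 2 (D₁ × D₂))) (d : WithLp 2 (D₁ × D₂)) :
    ∃ x y, d = schurLift T x + incl₂ y := by
  obtain ⟨x, y, rfl⟩ := exists_eq_incl₁_add_incl₂ d
  refine ⟨x, (block₂₂ T).inverse (block₂₁ T x) + y, ?_⟩
  rw [incl₁_eq_schurLift_add (T := T), map_add, add_assoc]

theorem apply_schurLift_incl₂ (h22 : (block₂₂ T).IsInvertible) (x : D₁) (y : D₂) :
    T (schurLift T x) (incl₂ y) = 0 := by
  have h1 : T (incl₂ ((block₂₂ T).inverse (block₂₁ T x))) (incl₂ y) = T (incl₁ x) (incl₂ y) :=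
    congrArg (fun f : AntiDual D₂ => f y) (h22.self_apply_inverse (block₂₁ T x))
  rw [schurLift_apply, map_sub, sub_apply, h1, sub_self]

theorem apply_schurLift_incl₁ (x y : D₁) :
    T (schurLift T x) (incl₁ y) = transfer T x y := by
  rw [schurLift_apply, map_sub, sub_apply]
  rfl

theorem apply_schurLift_schurLift (h22 : (block₂₂ T).IsInvertible) (x y : D₁) :
    T (schurLift T x) (schurLift T y) = transfer T x y := by
  rw [schurLift_apply (T := T) y, map_sub, apply_schurLift_incl₂ h22, sub_zero,
    apply_schurLift_incl₁]

theorem isHermitianForm_transfer (hT : IsHermitianForm T) (h22 : (block₂₂ T).IsInvertible) :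
    IsHermitianForm (transfer T) := fun x y => by
  rw [← apply_schurLift_schurLift h22, ← apply_schurLift_schurLift h22]
  exact hT _ _

theorem apply_schurLift_add_incl₂ (hT : IsHermitianForm T) (h22 : (block₂₂ T).IsInvertible)
    (x : D₁) (y : D₂) :
    T (schurLift T x + incl₂ y) (schurLift T x + incl₂ y) = transfer T x x + block₂₂ T y y := by
  have h1 : T (incl₂ y) (schurLift T x) = 0 := by
    rw [hT, apply_schurLift_incl₂ h22, map_zero]
  simp only [map_add, add_apply, apply_schurLift_schurLift h22, apply_schurLift_incl₂ h22, h1]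
  rw [zero_add, add_zero]
  rfl

/-- Drop the nonpositive `T₂₂` term from the completed square. -/
theorem re_apply_le_re_transfer (hT : IsHermitianForm T) (h22 : (block₂₂ T).IsInvertible)
    (h22n : CoerciveOn (-block₂₂ T) ⊤) (d : WithLp 2 (D₁ × D₂)) :
    (T d d).re ≤ (transfer T (proj₁ d) (proj₁ d)).re := by
  obtain ⟨x, y, rfl⟩ := exists_eq_schurLift_add_incl₂ T d
  have h1 : proj₁ (schurLift T x + incl₂ y) = x := by
    rw [map_add, schurLift_apply, map_sub, proj₁_incl₁, proj₁_incl₂, proj₁_incl₂]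
    simp
  have h2 := h22n.re_nonneg (Submodule.mem_top (x := y))
  simp only [neg_apply, Complex.neg_re] at h2
  rw [apply_schurLift_add_incl₂ hT h22, h1, Complex.add_re]
  linarith

theorem ker_eq_map_ker_transfer (h22 : (block₂₂ T).IsInvertible) :
    T.ker = (transfer T).ker.map (schurLift T).toLinearMap := by
  ext d
  constructor
  · intro hd
    have hd0 : T d = 0 := hd
    obtain ⟨x, y, rfl⟩ := exists_eq_schurLift_add_incl₂ T d
    -- Testing against `D₂` kills the lifted part and leaves `T₂₂ y = 0`.
    have hy : y = 0 := by
      refine h22.injective ?_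
      rw [map_zero]
      ext z
      have := congrArg (fun f : AntiDual (WithLp 2 (D₁ × D₂)) => f (incl₂ z)) hd0
      simp only [map_add, add_apply, apply_schurLift_incl₂ h22, zero_add] at this
      exact this
    subst hy
    refine ⟨x, LinearMap.mem_ker.mpr ?_, by simp⟩
    change transfer T x = 0
    ext z
    rw [map_zero, add_zero] at hd0
    rw [← apply_schurLift_incl₁, hd0]
    rfl
  · rintro ⟨x, hx, rfl⟩
    have hx0 : transfer T x = 0 := hx
    refine LinearMap.mem_ker.mpr ?_
    change T (schurLift T x) = 0
    ext d
    obtain ⟨u, v, rfl⟩ := exists_eq_incl₁_add_incl₂ d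
    rw [map_add, apply_schurLift_incl₁, apply_schurLift_incl₂ h22, hx0]
    simp

theorem injective_schurLift : Function.Injective (schurLift T) := by
  have h : Function.LeftInverse proj₁ (schurLift T) := fun x => by
    rw [schurLift_apply, map_sub, proj₁_incl₁, proj₁_incl₂, sub_zero]
  exact h.injective

variable [CompleteSpace D₂]

theorem isInvertible_block₂₂ (h22 : ∃ ε : ℝ, 0 < ε ∧ ∀ y : D₂,
      (block₂₂ T y y).im = 0 ∧ (block₂₂ T y y).re ≤ -ε * ‖y‖ ^ 2) :
    CoerciveOn (-block₂₂ T) ⊤ ∧ (block₂₂ T).IsInvertible := by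
  obtain ⟨ε, hε, h⟩ := h22
  have hc : CoerciveOn (-block₂₂ T) ⊤ := ⟨ε, hε, fun y _ => by
    have := (h y).2
    simp only [neg_apply, Complex.neg_re]
    linarith⟩
  exact ⟨hc, (isHermitianForm_of_im_eq_zero fun y => (h y).1).isInvertible_of_coerciveOn
    (coerciveOn_bot _) hc (by simp)⟩

variable [CompleteSpace D₁]

theorem isInvertible_of_transfer (h22 : (block₂₂ T).IsInvertible)
    (hS : (transfer T).IsInvertible) : T.IsInvertible := by
  refine isInvertible_of_bijective (A := T) ⟨?_, fun f => ?_⟩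
  · refine LinearMap.ker_eq_bot.mp (?_ : T.ker = ⊥)
    rw [ ker_eq_map_ker_transfer h22,
      LinearMap.ker_eq_bot.mpr hS.injective, Submodule.map_bot]
  · obtain ⟨y, hy⟩ := h22.surjective (f.comp incl₂)
    obtain ⟨x, hx⟩ := hS.surjective (f.comp incl₁ - block₁₂ T y)
    refine ⟨schurLift T x + incl₂ y, ?_⟩
    ext d
    obtain ⟨u, v, rfl⟩ := exists_eq_incl₁_add_incl₂ d
    have h1 : T (incl₂ y) (incl₂ v) = f (incl₂ v) :=
      congrArg (fun g : AntiDual D₂ => g v) hy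
    have h2 : transfer T x u = f (incl₁ u) - T (incl₂ y) (incl₁ u) :=
      congrArg (fun g : AntiDual D₁ => g u) hx
    simp only [map_add, add_apply, apply_schurLift_incl₂ h22, apply_schurLift_incl₁, h1, h2]
    abel

/-- Subtracting `K` in the `D₁` corner alone keeps `T₂₂` and replaces the transfer operator by the
uniformly positive `P`. -/
theorem exists_eq_isInvertible_add_isCompactOperator (h22 : (block₂₂ T).IsInvertible)
    (hS : IsCompactPerturbationOfUniformlyPositive (transfer T)) :
    ∃ Q K : WithLp 2 (D₁ × D₂) →L[ℂ] AntiDual (WithLp 2 (D₁ × D₂)),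
      Q.IsInvertible ∧ IsCompactOperator K ∧ T = Q + K := by
  obtain ⟨P, K, ⟨ε, hε, hP⟩, hK, hPK⟩ := hS
  let K' : WithLp 2 (D₁ × D₂) →L[ℂ] AntiDual (WithLp 2 (D₁ × D₂)) := compress proj₁ proj₁ K
  have hK' : IsCompactOperator K' :=
    (hK.comp_clm proj₁).clm_comp
      ((ContinuousLinearMap.compSL (WithLp 2 (D₁ × D₂)) D₁ ℂ (RingHom.id ℂ)
        (starRingEnd ℂ)).flip proj₁)
  refine ⟨T - K', K', ?_, hK', by abel⟩
  have h1 : block₂₂ (T - K') = block₂₂ T := by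
    ext x y
    change T (incl₂ x) (incl₂ y) - K (proj₁ (incl₂ x)) (proj₁ (incl₂ y)) = _
    rw [proj₁_incl₂, map_zero, zero_apply, sub_zero]
    rfl
  have h2 : transfer (T - K') = P := by
    have h21 : block₂₁ (T - K') = block₂₁ T := by
      ext x y
      change T (incl₁ x) (incl₂ y) - K (proj₁ (incl₁ x)) (proj₁ (incl₂ y)) = _
      rw [proj₁_incl₂, map_zero, sub_zero]
      rfl
    have h12 : block₁₂ (T - K') = block₁₂ T := by
      ext x y
      change T (incl₂ x) (incl₁ y) - K (proj₁ (incl₂ x)) (proj₁ (incl₁ y)) = _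
      rw [proj₁_incl₂, map_zero, zero_apply, sub_zero]
      rfl
    have h11 : block₁₁ (T - K') = block₁₁ T - K := by
      ext x y
      rfl
    have h3 : transfer (T - K') = transfer T - K := by
      rw [transfer, transfer, h11, h12, h21, h1]
      abel
    rw [h3, hPK]
    abel
  refine isInvertible_of_transfer (h1 ▸ h22) (h2 ▸ ?_)
  exact (isHermitianForm_of_im_eq_zero fun y => (hP y).1).isInvertible_of_coerciveOn (U := ⊤)
    ⟨ε, hε, fun x _ => (hP x).2⟩ (coerciveOn_bot _) (by simp)

/-- If `T` is coercive on a lift of `Z` and `-T` is coercive on the sum of a lift of `M` and `D₂`,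
then `T` is invertible and the negative index of its transfer operator is `dim M`. -/
theorem isInvertible_and_ind_transfer (hT : IsHermitianForm T) (h22 : (block₂₂ T).IsInvertible)
    (h22n : CoerciveOn (-block₂₂ T) ⊤) {J : D₁ →L[ℂ] WithLp 2 (D₁ × D₂)}
    (hJ : ∀ x, ∃ y, J x = incl₁ x + incl₂ y) {M Z : Submodule ℂ D₁} [FiniteDimensional ℂ M]
    (hZ : CoerciveOn T (Z.map J.toLinearMap))
    (hM : CoerciveOn (-T) (M.map J.toLinearMap ⊔ (incl₂ (D₁ := D₁) (D₂ := D₂)).range))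
    (hMZ : M ⊔ Z = ⊤) :
    T.IsInvertible ∧ ind (transfer T) = (Module.finrank ℂ M : ℕ∞) := by
  constructor
  · refine hT.isInvertible_of_coerciveOn hZ hM (eq_top_iff.mpr fun d _ => ?_)
    obtain ⟨x, y, rfl⟩ := exists_eq_incl₁_add_incl₂ d
    obtain ⟨m, hm, z, hz, rfl⟩ := Submodule.mem_sup.mp (hMZ ▸ Submodule.mem_top : x ∈ M ⊔ Z)
    obtain ⟨w, hw⟩ := hJ (m + z)
    have : incl₁ (m + z) + incl₂ y = J z + (J m + incl₂ (y - w)) := by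
      rw [map_add] at hw
      rw [map_sub, ← add_assoc, ← add_comm (J m), hw]
      abel
    rw [this]
    exact Submodule.add_mem_sup ⟨z, hz, rfl⟩ (Submodule.add_mem_sup ⟨m, hm, rfl⟩ ⟨_, rfl⟩)
  · refine ind_eq_finrank (fun x hx hx0 => ?_) (fun x hx => ?_) hMZ
    · rw [← apply_schurLift_schurLift h22]
      refine hM.re_neg ?_ (fun h => hx0 (injective_schurLift (by rw [h, map_zero])))
      obtain ⟨w, hw⟩ := hJ x
      -- `J` need not be the Schur lift of `T` itself; the two differ by a vector of `D₂`, which the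
      -- negative subspace contains.
      have : schurLift T x = J x + incl₂ (-w - (block₂₂ T).inverse (block₂₁ T x)) := by
        rw [schurLift_apply, hw, map_sub, map_neg]
        abel
      rw [this]
      exact Submodule.add_mem_sup ⟨x, hx, rfl⟩ ⟨_, rfl⟩
    · have h1 := re_apply_le_re_transfer hT h22 h22n (J x)
      obtain ⟨w, hw⟩ := hJ x
      have h2 : proj₁ (J x) = x := by rw [hw, map_add, proj₁_incl₁, proj₁_incl₂, add_zero]
      rw [h2] at h1
      exact (hZ.re_nonneg ⟨x, hx, rfl⟩).trans h1

end Blocks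


/-! ### Quantitative perturbation of definite subspaces. -/

section Perturbation

/-- A family of operators that is strongly `C¹` on a compact interval is Lipschitz in norm. -/
theorem exists_norm_sub_le_of_contDiffOn {X Y : Type*} [NormedAddCommGroup X] [NormedSpace ℂ X]
    [CompleteSpace X] [NormedAddCommGroup Y] [NormedSpace ℂ Y] [NormedSpace ℝ Y]
    {T : ℝ → X →L[ℂ] Y} {a b : ℝ} (h : ∀ x, ContDiffOn ℝ 1 (fun l => T l x) (Icc a b)) :
    ∃ L : ℝ, 0 ≤ L ∧ ∀ l ∈ Icc a b, ∀ m ∈ Icc a b, ‖T l - T m‖ ≤ L * |l - m| := by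
  -- Difference quotients over all pairs: bounded on each vector by the `C¹` hypothesis, hence
  -- bounded in norm by uniform boundedness. Pairs with `l = m` give zero.
  let g : {p : ℝ × ℝ // p.1 ∈ Icc a b ∧ p.2 ∈ Icc a b} → X →L[ℂ] Y :=
    fun p => ((p.1.1 - p.1.2 : ℝ) : ℂ)⁻¹ • (T p.1.1 - T p.1.2)
  obtain ⟨L, hL⟩ := banach_steinhaus (g := g) fun x => by
    obtain ⟨K, hK⟩ := (h x).exists_lipschitzOnWith one_ne_zero (convex_Icc a b) isCompact_Icc
    refine ⟨K, fun ⟨⟨l, m⟩, hl, hm⟩ => ?_⟩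
    have h1 : ‖T l x - T m x‖ ≤ K * |l - m| := by
      simpa [dist_eq_norm, Real.norm_eq_abs] using hK.dist_le_mul l hl m hm
    simp only [g, smul_apply, sub_apply, norm_smul, norm_inv, Complex.norm_real, Real.norm_eq_abs]
    by_cases h0 : |l - m| = 0
    · simp [h0]
    · rw [inv_mul_le_iff₀ (lt_of_le_of_ne (abs_nonneg _) (Ne.symm h0)), mul_comm]
      exact h1
  refine ⟨max L 0, le_max_right _ _, fun l hl m hm => ?_⟩
  have h1 := hL ⟨(l, m), hl, hm⟩
  simp only [g, norm_smul, norm_inv, Complex.norm_real, Real.norm_eq_abs] at h1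
  by_cases h0 : l = m
  · simp [h0]
  · have h2 : 0 < |l - m| := abs_pos.mpr (sub_ne_zero.mpr h0)
    rw [inv_mul_le_iff₀ h2, mul_comm] at h1
    exact h1.trans (mul_le_mul_of_nonneg_right (le_max_left _ _) h2.le)

variable {D : Type*} [NormedAddCommGroup D] [InnerProductSpace ℂ D]

theorem norm_neg_sub_neg_le {A A₀ : D →L[ℂ] AntiDual D} {r : ℝ} (h : ‖A - A₀‖ ≤ r) :
    ‖-A - -A₀‖ ≤ r := by
  have h1 : -A - -A₀ = A₀ - A := by
    ext x y
    simp only [sub_apply, neg_apply]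
    ring
  rw [h1]
  exact (norm_sub_rev A₀ A).trans_le h

/-- Vectors of `N` are `A₀`-orthogonal to everything, so the cross terms are at most `L h`. The
determinant condition `(L h)² < (c - L h) δ h` is `hsmall` times `h`. -/
theorem coerciveOn_sup_of_norm_sub_le {A₀ A : D →L[ℂ] AntiDual D} (hA : IsHermitianForm A)
    (hA₀ : IsHermitianForm A₀) {U N : Submodule ℂ D} {c L δ h : ℝ} (hδ : 0 < δ)
    (hU : ∀ u ∈ U, c * ‖u‖ ^ 2 ≤ (A₀ u u).re) (hN : N ≤ A₀.ker) (hAA₀ : ‖A - A₀‖ ≤ L * h)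
    (hpos : ∀ n ∈ N, δ * h * ‖n‖ ^ 2 ≤ (A n n).re) (hh : 0 < h)
    (hsmall : L ^ 2 * h < (c - L * h) * δ) : CoerciveOn A (U ⊔ N) := by
  have hsub : ∀ x y, ‖A x y - A₀ x y‖ ≤ L * h * ‖x‖ * ‖y‖ := fun x y =>
    (norm_form_le (A - A₀) x y).trans (by gcongr)
  have hc : 0 < c - L * h := by
    by_contra! hcon
    have : 0 ≤ L ^ 2 * h := by positivity
    nlinarith
  refine coerciveOn_sup (e := L * h) hA hc (mul_pos hδ hh) ?_ (fun u hu => ?_) hpos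
    fun u _ n hn => ?_
  · nlinarith
  · have h1 := (abs_le.mp ((Complex.abs_re_le_norm _).trans (hsub u u))).1
    have h2 := hU u hu
    rw [Complex.sub_re] at h1
    nlinarith
  · have h1 := hsub u n
    have h2 : A₀ n = 0 := hN hn
    have h3 : A₀ u n = 0 := by rw [hA₀ u n, h2]; simp
    rwa [h3, sub_zero] at h1

/-- Uniformity of a negative derivative of the quadratic form on a finite-dimensional subspace of
the kernel. -/
theorem exists_forall_mul_re_le_of_hasDerivAt {T : ℝ → D →L[ℂ] AntiDual D} {s : Set ℝ} {μ L : ℝ}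
    (hL : 0 ≤ L) (hLip : ∀ l ∈ s, ‖T l - T μ‖ ≤ L * |l - μ|) {N : Submodule ℂ D}
    [FiniteDimensional ℂ N] (hN : N ≤ (T μ).ker)
    (hneg : ∀ y ∈ N, y ≠ 0 → ∃ d : ℝ, d < 0 ∧ HasDerivAt (fun l : ℝ => (T l y y).re) d μ) :
    ∃ δ : ℝ, 0 < δ ∧ ∀ᶠ l in 𝓝[s] μ, ∀ y ∈ N,
      (l - μ) * (T l y y).re ≤ -δ * (l - μ) ^ 2 * ‖y‖ ^ 2 := by
  have : ProperSpace N := FiniteDimensional.proper ℂ N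
  have hker : ∀ y : N, T μ y = 0 := fun y => hN y.2
  have key : ∃ δ : ℝ, 0 < δ ∧ ∀ᶠ l in 𝓝[s] μ, ∀ y ∈ Metric.sphere (0 : N) 1,
      (l - μ) * (T l y y).re ≤ -δ * (l - μ) ^ 2 := by
    refine (isCompact_sphere (0 : N) 1).induction_on
      (p := fun t => ∃ δ : ℝ, 0 < δ ∧ ∀ᶠ l in 𝓝[s] μ, ∀ y ∈ t,
        (l - μ) * (T l y y).re ≤ -δ * (l - μ) ^ 2) ?_ ?_ ?_ ?_
    · exact ⟨1, one_pos, by simp⟩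
    · rintro t u htu ⟨δ, hδ, h⟩
      exact ⟨δ, hδ, h.mono fun l hl y hy => hl y (htu hy)⟩
    · rintro t u ⟨δ, hδ, h⟩ ⟨δ', hδ', h'⟩
      refine ⟨min δ δ', lt_min hδ hδ', ?_⟩
      filter_upwards [h, h'] with l hl hl' y hy
      rcases hy with hy | hy
      · nlinarith [hl y hy, min_le_left δ δ', sq_nonneg (l - μ)]
      · nlinarith [hl' y hy, min_le_right δ δ', sq_nonneg (l - μ)]
    · intro x hx
      have hx1 : ‖x‖ = 1 := by simpa using hx
      obtain ⟨d, hd, hder⟩ := hneg x x.2 (by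
        intro h
        have : x = 0 := by simpa using h
        simp [this] at hx1)
      -- With this radius, moving from `x` to `y` costs at most `(-d/4)|l - μ|`, as does the
      -- remainder of the derivative at `x`; slope `d/2` survives. `L + 1` avoids dividing by zero.
      refine ⟨Metric.ball x (-d / (8 * (L + 1))) ∩ Metric.sphere 0 1, ?_, -d / 2, by linarith, ?_⟩
      · exact Filter.inter_mem (mem_nhdsWithin_of_mem_nhds (Metric.ball_mem_nhds x
          (div_pos (by linarith) (by positivity)))) self_mem_nhdsWithin
      · have ho := (hasDerivAt_iff_isLittleO.mp hder).bound (c := -d / 4) (by linarith)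
        filter_upwards [nhdsWithin_le_nhds ho, self_mem_nhdsWithin] with l hl hls y hy
        have hy1 : ‖y‖ = 1 := by simpa using hy.2
        have hyx : ‖y - x‖ ≤ -d / (8 * (L + 1)) := by
          rw [← dist_eq_norm]; exact (Metric.mem_ball.mp hy.1).le
        simp only [hker x, zero_apply, Complex.zero_re, sub_zero, smul_eq_mul,
          Real.norm_eq_abs] at hl
        have h1 : T l y y - T l x x =
            (T l - T μ) ((y - x : N) : D) y + (T l - T μ) x ((y - x : N) : D) := by
          simp [hker]
        have h2 : ‖T l y y - T l x x‖ ≤ (-d / 4) * |l - μ| := by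
          rw [h1]
          have h3 := norm_form_le (T l - T μ) ((y - x : N) : D) y
          have h4 := norm_form_le (T l - T μ) x ((y - x : N) : D)
          have hy1' : ‖(y : D)‖ = 1 := hy1
          have hx1' : ‖(x : D)‖ = 1 := hx1
          have h5 : ‖((y - x : N) : D)‖ = ‖y - x‖ := rfl
          rw [h5, hy1', mul_one] at h3
          rw [h5, hx1', mul_one] at h4
          have h6 : ‖T l - T μ‖ * ‖y - x‖ ≤ (L * |l - μ|) * (-d / (8 * (L + 1))) := by
            gcongr
            exact hLip l hls
          have h7 : (L * |l - μ|) * (-d / (8 * (L + 1))) ≤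
              ((L + 1) * |l - μ|) * (-d / (8 * (L + 1))) :=
            mul_le_mul_of_nonneg_right (by nlinarith [abs_nonneg (l - μ)])
              (div_nonneg (by linarith) (by positivity))
          have h8 : ((L + 1) * |l - μ|) * (-d / (8 * (L + 1))) = (-d / 8) * |l - μ| := by
            field_simp
          linarith [norm_add_le ((T l - T μ) ((y - x : N) : D) y)
            ((T l - T μ) x ((y - x : N) : D))]
        have h9 := (Complex.abs_re_le_norm _).trans h2
        rw [Complex.sub_re] at h9
        have h10 : |(T l y y).re - d * (l - μ)| ≤ (-d / 2) * |l - μ| := by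
          have : (T l y y).re - d * (l - μ) =
            ((T l y y).re - (T l x x).re) + ((T l x x).re - (l - μ) * d) := by ring
          rw [this]
          refine (abs_add_le _ _).trans ?_
          linarith
        have h11 : (l - μ) * ((T l y y).re - d * (l - μ)) ≤ |l - μ| * ((-d / 2) * |l - μ|) := by
          refine (le_abs_self _).trans ?_
          rw [abs_mul]
          gcongr
        have h12 : |l - μ| * |l - μ| = (l - μ) ^ 2 := by rw [← sq, sq_abs]
        nlinarith
  obtain ⟨δ, hδ, h⟩ := key
  refine ⟨δ, hδ, h.mono fun l hl y hy => ?_⟩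
  by_cases hy0 : y = 0
  · simp [hy0]
  have hn : ‖y‖ ≠ 0 := norm_ne_zero_iff.mpr hy0
  let v : N := ((‖y‖⁻¹ : ℝ) : ℂ) • ⟨y, hy⟩
  have hv : (v : D) = ((‖y‖⁻¹ : ℝ) : ℂ) • y := rfl
  have h1 := hl v (by
    rw [mem_sphere_zero_iff_norm]
    change ‖(v : D)‖ = 1
    rw [hv, norm_smul, Complex.norm_real, norm_inv, norm_norm, inv_mul_cancel₀ hn])
  have h2 : (T l v v).re = (‖y‖ ^ 2)⁻¹ * (T l y y).re := by
    rw [hv]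
    simp only [map_smul, smul_apply, ContinuousLinearMap.map_smulₛₗ, Complex.conj_ofReal,
      smul_eq_mul, Complex.re_ofReal_mul]
    field_simp
  have h3 : (T l y y).re = ‖y‖ ^ 2 * (T l v v).re := by
    rw [h2]
    field_simp
  rw [h3]
  nlinarith [mul_le_mul_of_nonneg_left h1 (sq_nonneg ‖y‖)]

end Perturbation

/-! ### The jump of the index at one point. -/

section Local

variable {D₁ D₂ : Type*}
  [NormedAddCommGroup D₁] [InnerProductSpace ℂ D₁] [CompleteSpace D₁]
  [NormedAddCommGroup D₂] [InnerProductSpace ℂ D₂] [CompleteSpace D₂]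

/-- Behaviour near a point at which all eigenvalues are of negative type: the negative index of the
transfer operator jumps by the multiplicity of the eigenvalue. -/
theorem exists_ind_transfer_eventually
    {T : ℝ → WithLp 2 (D₁ × D₂) →L[ℂ] AntiDual (WithLp 2 (D₁ × D₂))} {s : Set ℝ} {μ L : ℝ}
    (hμ : μ ∈ s) (hL : 0 ≤ L) (hLip : ∀ l ∈ s, ‖T l - T μ‖ ≤ L * |l - μ|)
    (hT : ∀ l ∈ s, IsHermitianForm (T l)) (h22 : ∀ l ∈ s, (block₂₂ (T l)).IsInvertible)
    (h22n : ∀ l ∈ s, CoerciveOn (-block₂₂ (T l)) ⊤)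
    (hS : IsCompactPerturbationOfUniformlyPositive (transfer (T μ)))
    (hneg : ∀ y, T μ y = 0 → y ≠ 0 →
      ∃ d : ℝ, d < 0 ∧ HasDerivAt (fun l : ℝ => (T l y y).re) d μ) :
    ∃ n : ℕ, ind (transfer (T μ)) = n ∧ FiniteDimensional ℂ (T μ).ker ∧
      ((T μ).ker = ⊥ → (T μ).IsInvertible) ∧
      ∀ᶠ l in 𝓝[s] μ,
        (l < μ → (T l).IsInvertible ∧ ind (transfer (T l)) = n) ∧
        (μ < l → (T l).IsInvertible ∧
          ind (transfer (T l)) = (n + Module.finrank ℂ (T μ).ker : ℕ)) := by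
  obtain ⟨M, U, hMfin, hNfin, hU, hM, htop⟩ :=
    exists_decomposition (isHermitianForm_transfer (hT μ hμ) (h22 μ hμ)) hS
  set N := (transfer (T μ)).ker with hNdef
  set J := schurLift (T μ) with hJdef
  have hJ : ∀ x, ∃ y, J x = incl₁ x + incl₂ y := fun x =>
    ⟨-(block₂₂ (T μ)).inverse (block₂₁ (T μ) x), by
      rw [hJdef, schurLift_apply, map_neg, sub_eq_add_neg]⟩
  have hker : (T μ).ker = N.map J.toLinearMap := ker_eq_map_ker_transfer (h22 μ hμ)
  have hrank : Module.finrank ℂ (T μ).ker = Module.finrank ℂ N := by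
    rw [hker]
    exact (Submodule.equivMapOfInjective J.toLinearMap injective_schurLift N).finrank_eq.symm
  have hkerfin : FiniteDimensional ℂ (T μ).ker := by rw [hker]; infer_instance
  have hU' : CoerciveOn (T μ) (U.map J.toLinearMap) :=
    hU.map J fun x _ => apply_schurLift_schurLift (h22 μ hμ) x x
  have hV' : CoerciveOn (-T μ) (M.map J.toLinearMap ⊔ (incl₂ (D₁ := D₁) (D₂ := D₂)).range) := by
    refine (hM.map (A := -T μ) J fun x _ => ?_).sup (hT μ hμ).neg ?_ ?_
    · rw [neg_apply, neg_apply, hJdef, apply_schurLift_schurLift (h22 μ hμ)]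
      rfl
    · have := (h22n μ hμ).map (A := -T μ) (incl₂ (D₁ := D₁) (D₂ := D₂)) fun x _ => rfl
      rwa [Submodule.map_top] at this
    · rintro _ ⟨x, _, rfl⟩ _ ⟨y, rfl⟩
      exact neg_eq_zero.mpr (apply_schurLift_incl₂ (h22 μ hμ) x y)
  have hdisj : M ⊓ N = ⊥ := by
    rw [Submodule.eq_bot_iff]
    rintro x ⟨hxM, hxN⟩
    by_contra hx0
    have h1 : transfer (T μ) x = 0 := hxN
    exact (hM.re_neg hxM hx0).ne (by simp [h1])
  have hMN : Module.finrank ℂ ↥(M ⊔ N) = Module.finrank ℂ M + Module.finrank ℂ N := by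
    have := Submodule.finrank_sup_add_finrank_inf_eq M N
    rwa [hdisj, finrank_bot, add_zero] at this
  have htop' : M ⊔ (U ⊔ N) = ⊤ := by rw [sup_comm U N, ← sup_assoc, htop]
  refine ⟨Module.finrank ℂ M, ?_, hkerfin, ?_, ?_⟩
  · refine ind_eq_finrank (fun y hy hy0 => hM.re_neg hy hy0) (fun y hy => ?_) htop'
    obtain ⟨u, hu, n, hn, rfl⟩ := Submodule.mem_sup.mp hy
    have h1 : transfer (T μ) n = 0 := hn
    have h2 : transfer (T μ) u n = 0 := by
      rw [isHermitianForm_transfer (hT μ hμ) (h22 μ hμ) u n, h1]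
      simp
    simpa [h1, h2] using hU.re_nonneg hu
  · intro h0
    have hN0 : N = ⊥ := by
      rw [hker] at h0
      exact Submodule.map_injective_of_injective (f := J.toLinearMap) injective_schurLift
        (h0.trans (Submodule.map_bot _).symm)
    rw [hN0, sup_bot_eq] at htop'
    exact (isInvertible_and_ind_transfer (hT μ hμ) (h22 μ hμ) (h22n μ hμ) hJ hU' hV' htop').1
  · obtain ⟨δ, hδ, hder⟩ := exists_forall_mul_re_le_of_hasDerivAt hL hLip le_rfl
      (N := (T μ).ker) fun y hy hy0 => hneg y hy hy0
    obtain ⟨c, hc, hU'⟩ := hU'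
    obtain ⟨d, hd, hV'⟩ := hV'
    -- At `l = μ` this reads `0 < a δ`, so it holds nearby by continuity.
    have hsmall : ∀ a : ℝ, 0 < a → ∀ᶠ l in 𝓝[s] μ, L ^ 2 * |l - μ| < (a - L * |l - μ|) * δ := by
      intro a ha
      refine nhdsWithin_le_nhds (ContinuousAt.eventually_lt (x₀ := μ) (by fun_prop) (by fun_prop) ?_)
      simpa using mul_pos ha hδ
    filter_upwards [hder, hsmall c hc, hsmall d hd, self_mem_nhdsWithin] with l hl hlc hld hls
    have hneg_sub : ‖-T l - -T μ‖ ≤ L * |l - μ| := norm_neg_sub_neg_le (hLip l hls)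
    have hbot : ∀ (A : WithLp 2 (D₁ × D₂) →L[ℂ] AntiDual (WithLp 2 (D₁ × D₂))),
        ∀ n ∈ (⊥ : Submodule ℂ (WithLp 2 (D₁ × D₂))), δ * |l - μ| * ‖n‖ ^ 2 ≤ (A n n).re := by
      intro A n hn
      simp [(Submodule.mem_bot ℂ).mp hn]
    constructor
    · intro hlt
      have habs : |l - μ| = μ - l := by rw [abs_of_neg (by linarith)]; ring
      -- To the left of `μ` the form is positive on the kernel, which enlarges the coercive part.
      have h1 : CoerciveOn (T l) ((U ⊔ N).map J.toLinearMap) := by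
        rw [Submodule.map_sup, ← hker]
        refine coerciveOn_sup_of_norm_sub_le (hT l hls) (hT μ hμ) hδ hU' le_rfl (hLip l hls)
          (fun n hn => ?_) (by rw [habs]; linarith) hlc
        have := hl n hn
        rw [habs]
        have h2 : 0 < μ - l := by linarith
        refine le_of_mul_le_mul_left ?_ h2
        nlinarith
      have h2 := coerciveOn_sup_of_norm_sub_le (hT l hls).neg (hT μ hμ).neg hδ hV' bot_le hneg_sub
        (hbot _) (by rw [habs]; linarith) hld
      rw [sup_bot_eq] at h2
      exact isInvertible_and_ind_transfer (hT l hls) (h22 l hls) (h22n l hls) hJ h1 h2 htop'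
    · intro hlt
      have habs : |l - μ| = l - μ := abs_of_pos (by linarith)
      have h1 := coerciveOn_sup_of_norm_sub_le (hT l hls) (hT μ hμ) hδ hU' bot_le (hLip l hls)
        (hbot _) (by rw [habs]; linarith) hlc
      rw [sup_bot_eq] at h1
      -- To the right the form is negative on the kernel, so the negative part grows by `dim N`.
      have h2 : CoerciveOn (-T l)
          ((M ⊔ N).map J.toLinearMap ⊔ (incl₂ (D₁ := D₁) (D₂ := D₂)).range) := by
        rw [Submodule.map_sup, ← hker, sup_right_comm]
        refine coerciveOn_sup_of_norm_sub_le (hT l hls).neg (hT μ hμ).neg hδ hV'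
          (fun n hn => ?_) hneg_sub (fun n hn => ?_) (by rw [habs]; linarith) hld
        · have h0 : T μ n = 0 := hn
          refine LinearMap.mem_ker.mpr ?_
          change -T μ n = 0
          rw [h0, neg_zero]
        · have := hl n hn
          rw [habs, neg_apply, neg_apply, Complex.neg_re]
          have h2 : 0 < l - μ := by linarith
          refine le_of_mul_le_mul_left ?_ h2
          nlinarith
      have h3 := isInvertible_and_ind_transfer (hT l hls) (h22 l hls) (h22n l hls) hJ h1 h2 htop
      rwa [hMN, ← hrank] at h3

end Local


/-! ### Summing the jumps of an integer step function. -/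

section Counting

/-- A step function `n` on a compact interval whose jump immediately to the right of `μ` is `k μ`
increases by the sum of all jumps. -/
theorem exists_finset_eq_add_sum {n k : ℝ → ℕ} {a b : ℝ} (hab : a ≤ b)
    (h : ∀ μ ∈ Icc a b, ∀ᶠ l in 𝓝[Icc a b] μ,
      (l < μ → n l = n μ ∧ k l = 0) ∧ (μ < l → n l = n μ + k μ ∧ k l = 0)) :
    ∃ F : Finset ℝ, (∀ x, x ∈ F ↔ x ∈ Icc a b ∧ k x ≠ 0) ∧
      n b = n a + ∑ y ∈ F, if y < b then k y else 0 := by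
  have hfin : {x | x ∈ Icc a b ∧ k x ≠ 0}.Finite := by
    have : (Icc a b ∩ {x | x ∈ Icc a b ∧ k x ≠ 0}).Finite := by
      refine isCompact_Icc.induction_on (p := fun t => (t ∩ {x | x ∈ Icc a b ∧ k x ≠ 0}).Finite)
        (by simp) (fun t u htu hu => hu.subset (inter_subset_inter_left _ htu))
        (fun t u ht hu => by rw [union_inter_distrib_right]; exact ht.union hu) fun μ hμ => ?_
      refine ⟨_, h μ hμ, (finite_singleton μ).subset ?_⟩
      rintro l ⟨hl, _, hk⟩
      by_contra hne
      rcases lt_or_gt_of_ne hne with hlt | hlt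
      · exact hk (hl.1 hlt).2
      · exact hk (hl.2 hlt).2
    exact this.subset fun x hx => ⟨hx.1, hx⟩
  set F := hfin.toFinset with hF
  have hmem : ∀ x, x ∈ F ↔ x ∈ Icc a b ∧ k x ≠ 0 := fun x => by simp [hF]
  refine ⟨F, hmem, ?_⟩
  -- Removing the jumps accumulated strictly to the left leaves a locally constant function, hence a
  -- constant on the connected interval. Strictness matters: the jump at `y` is felt only to the
  -- right of `y`.
  let g : ℝ → ℤ := fun x => n x - ∑ y ∈ F, if y < x then (k y : ℤ) else 0
  have hcont : ContinuousOn g (Icc a b) := by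
    intro μ hμ
    have hnear : ∀ᶠ l in 𝓝[Icc a b] μ, ∀ y ∈ F, y ≠ μ → (y < l ↔ y < μ) := by
      rw [Filter.eventually_all_finset]
      intro y _
      by_cases hy : y = μ
      · simp [hy]
      rcases lt_or_gt_of_ne hy with hlt | hlt
      · filter_upwards [nhdsWithin_le_nhds (lt_mem_nhds hlt)] with l hl _
        exact iff_of_true hl hlt
      · filter_upwards [nhdsWithin_le_nhds (gt_mem_nhds hlt)] with l hl _
        exact iff_of_false hl.not_gt hlt.not_gt
    have hconst : ∀ᶠ l in 𝓝[Icc a b] μ, g μ = g l := by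
      filter_upwards [h μ hμ, hnear] with l hl hnl
      rcases lt_trichotomy l μ with hlt | rfl | hlt
      · simp only [g, (hl.1 hlt).1]
        congr 1
        refine Finset.sum_congr rfl fun y hy => ?_
        by_cases hyμ : y = μ
        · simp [hyμ, hlt.le]
        · simp only [hnl y hy hyμ]
      · rfl
      · have h1 : ∑ y ∈ F, (if y < l then (k y : ℤ) else 0) =
            (∑ y ∈ F, if y < μ then (k y : ℤ) else 0) + k μ := by
          have h2 : (k μ : ℤ) = ∑ y ∈ F, if y = μ then (k y : ℤ) else 0 := by
            rw [Finset.sum_ite_eq']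
            split_ifs with hμF
            · rfl
            · rw [hmem, not_and, not_not] at hμF
              simp [hμF hμ]
          rw [h2, ← Finset.sum_add_distrib]
          refine Finset.sum_congr rfl fun y hy => ?_
          by_cases hyμ : y = μ
          · simp [hyμ, hlt]
          · simp only [hnl y hy hyμ, if_neg hyμ, add_zero]
        simp only [g, (hl.2 hlt).1, h1]
        push_cast
        ring
    exact tendsto_const_nhds.congr' hconst
  have hg := isPreconnected_Icc.constant hcont (left_mem_Icc.mpr hab) (right_mem_Icc.mpr hab)
  have ha : ∑ y ∈ F, (if y < a then (k y : ℤ) else 0) = 0 :=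
    Finset.sum_eq_zero fun y hy => if_neg (not_lt.mpr ((hmem y).mp hy).1.1)
  simp only [g, ha, sub_zero] at hg
  zify
  linarith

end Counting

/-! ### Transferring kernel and spectrum between `T` and `T^•`. -/

section Bullet

variable {D H : Type*}
  [NormedAddCommGroup D] [InnerProductSpace ℂ D]
  [NormedAddCommGroup H] [InnerProductSpace ℂ H]
  {I : D →L[ℂ] H} {T : D →L[ℂ] AntiDual D}

theorem hasBoundedInverse_bullet (hI : Function.Injective I) (hd : DenseRange I)
    (hT : T.IsInvertible) : HasBoundedInverse (bullet I T) := by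
  refine ⟨I.comp (T.inverse.comp (adjointEmbedding I)), fun h => ?_, fun x => ?_⟩
  · exact (mem_bullet_graph_iff I hI hd T _ _).mpr
      ⟨T.inverse (adjointEmbedding I h), rfl, hT.self_apply_inverse _⟩
  · obtain ⟨y, hy, hTy⟩ := (mem_bullet_graph_iff I hI hd T _ _).mp
      ((bullet I T).mem_graph x)
    change I (T.inverse (adjointEmbedding I (bullet I T x))) = x
    rw [← hTy, hT.inverse_apply_self, hy]

theorem map_ker_bullet (hI : Function.Injective I) (hd : DenseRange I) :
    (LinearMap.ker (bullet I T).toFun).map (bullet I T).domain.subtype =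
      T.ker.map I.toLinearMap := by
  ext x
  have h : (x, (0 : H)) ∈ (bullet I T).graph ↔ ∃ y, I y = x ∧ T y = 0 := by
    rw [mem_bullet_graph_iff I hI hd T x 0, map_zero]
  constructor
  · rintro ⟨u, hu, rfl⟩
    have hu0 : bullet I T u = 0 := hu
    obtain ⟨y, hy, hTy⟩ := h.mp (by rw [← hu0]; exact (bullet I T).mem_graph u)
    exact ⟨y, hTy, hy⟩
  · rintro ⟨y, hy, rfl⟩
    obtain ⟨u, hu, hu0⟩ := (LinearPMap.mem_graph_iff _).mp (h.mpr ⟨y, rfl, hy⟩)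
    exact ⟨u, hu0, hu⟩

theorem kernelDim_bullet (hI : Function.Injective I) (hd : DenseRange I)
    [FiniteDimensional ℂ T.ker] :
    kernelDim (bullet I T) = (Module.finrank ℂ T.ker : ℕ∞) := by
  have e1 := Submodule.equivMapOfInjective (bullet I T).domain.subtype
    (Submodule.injective_subtype _) (LinearMap.ker (bullet I T).toFun)
  rw [map_ker_bullet hI hd] at e1
  have e := (Submodule.equivMapOfInjective I.toLinearMap hI T.ker).trans e1.symm
  have hfin : FiniteDimensional ℂ (LinearMap.ker (bullet I T).toFun) := e.finiteDimensional
  rw [kernelDim, ← Module.finrank_eq_rank, Cardinal.toENat_nat, e.finrank_eq]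

theorem ker_eq_bot_of_hasBoundedInverse_bullet (hI : Function.Injective I) (hd : DenseRange I)
    (h : HasBoundedInverse (bullet I T)) : T.ker = ⊥ := by
  obtain ⟨R, _, hR⟩ := h
  rw [Submodule.eq_bot_iff]
  intro y hy
  obtain ⟨u, hu, hu0⟩ := (LinearPMap.mem_graph_iff _).mp
    ((mem_bullet_graph_iff I hI hd T (I y) 0).mpr ⟨y, rfl, by rw [map_zero]; exact hy⟩)
  have h1 := hR u
  simp only at hu hu0
  rw [hu0, map_zero, hu] at h1
  exact hI (by rw [← h1, map_zero])

theorem totalMultiplicity_eq_sum {A : ℝ → H →ₗ.[ℂ] H} {Δ : Set ℝ} {F : Finset ℝ}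
    (hF : (F : Set ℝ) = spectrumIn A Δ) :
    totalMultiplicity A Δ = ∑ μ ∈ F, kernelDim (A μ) := by
  refine le_antisymm (iSup_le fun ⟨G, hG⟩ => ?_) ?_
  · exact Finset.sum_le_sum_of_subset (by rw [← hF] at hG; exact_mod_cast hG)
  · exact le_iSup (fun F : {F : Finset ℝ // (F : Set ℝ) ⊆ spectrumIn A Δ} =>
      ∑ μ ∈ F.1, kernelDim (A μ)) ⟨F, hF.subset⟩

end Bullet

/-! ### The embedding of the direct sum. -/

section DirectSum

variable {D₁ D₂ H₁ H₂ : Type*}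
  [NormedAddCommGroup D₁] [InnerProductSpace ℂ D₁]
  [NormedAddCommGroup D₂] [InnerProductSpace ℂ D₂]
  [NormedAddCommGroup H₁] [InnerProductSpace ℂ H₁]
  [NormedAddCommGroup H₂] [InnerProductSpace ℂ H₂]
  {I₁ : D₁ →L[ℂ] H₁} {I₂ : D₂ →L[ℂ] H₂}

theorem injective_directSum (h₁ : Function.Injective I₁) (h₂ : Function.Injective I₂) :
    Function.Injective (directSum I₁ I₂) :=
  (WithLp.prodContinuousLinearEquiv 2 ℂ H₁ H₂).symm.injective.comp
    ((h₁.prodMap h₂).comp (WithLp.prodContinuousLinearEquiv 2 ℂ D₁ D₂).injective)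

theorem denseRange_directSum (h₁ : DenseRange I₁) (h₂ : DenseRange I₂) :
    DenseRange (directSum I₁ I₂) :=
  (WithLp.prodContinuousLinearEquiv 2 ℂ H₁ H₂).symm.surjective.denseRange.comp
    ((h₁.prodMap h₂).comp (WithLp.prodContinuousLinearEquiv 2 ℂ D₁ D₂).surjective.denseRange
      (I₁.prodMap I₂).continuous) (WithLp.prodContinuousLinearEquiv 2 ℂ H₁ H₂).symm.continuous

end DirectSum

end Rigged

end

/-! ### The global count. -/

theorem mainTheorem10
    {H₁ H₂ D₁ D₂ : Type*}
    [NormedAddCommGroup H₁] [InnerProductSpace ℂ H₁] [CompleteSpace H₁]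
    [NormedAddCommGroup H₂] [InnerProductSpace ℂ H₂] [CompleteSpace H₂]
    [NormedAddCommGroup D₁] [InnerProductSpace ℂ D₁] [CompleteSpace D₁]
    [NormedAddCommGroup D₂] [InnerProductSpace ℂ D₂] [CompleteSpace D₂]
    (I₁ : D₁ →L[ℂ] H₁) (hI₁ : Function.Injective I₁) (hI₁d : DenseRange I₁)
    (I₂ : D₂ →L[ℂ] H₂) (hI₂ : Function.Injective I₂) (hI₂d : DenseRange I₂)
    (ζm ζp : ℝ) (hζ : ζm < ζp)
    (T : ℝ → WithLp 2 (D₁ × D₂) →L[ℂ] Rigged.AntiDual (WithLp 2 (D₁ × D₂)))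
    (hsmooth : ∀ x : WithLp 2 (D₁ × D₂), ContDiffOn ℝ 1 (fun l : ℝ => T l x) (Icc ζm ζp))
    (hsa : ∀ l ∈ Icc ζm ζp, IsSelfAdjoint (Rigged.bullet (Rigged.directSum I₁ I₂) (T l)))
    (h22 : ∃ ε : ℝ, 0 < ε ∧ ∀ l ∈ Icc ζm ζp, ∀ y : D₂,
      (Rigged.block₂₂ (T l) y y).im = 0 ∧ (Rigged.block₂₂ (T l) y y).re ≤ -ε * ‖y‖ ^ 2)
    (hScont : ContinuousOn (fun l : ℝ => Rigged.transfer (T l)) (Icc ζm ζp))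
    (hScomp : ∀ l ∈ Icc ζm ζp,
      Rigged.IsCompactPerturbationOfUniformlyPositive (Rigged.transfer (T l)))
    (hneg : Rigged.EigenvaluesOfNegativeType T (Ioo ζm ζp))
    (hm : (T ζm).IsInvertible) (hp : (T ζp).IsInvertible) :
    Rigged.IsPurelyDiscreteIn
        (fun l : ℝ => Rigged.bullet (Rigged.directSum I₁ I₂) (T l)) (Ioo ζm ζp) ∧
      Rigged.ind (Rigged.transfer (T ζm)) ≠ ⊤ ∧
      Rigged.ind (Rigged.transfer (T ζp)) ≠ ⊤ ∧
      Rigged.totalMultiplicity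
          (fun l : ℝ => Rigged.bullet (Rigged.directSum I₁ I₂) (T l)) (Ioo ζm ζp) +
        Rigged.ind (Rigged.transfer (T ζm)) = Rigged.ind (Rigged.transfer (T ζp)) := by
  open Rigged in
  have hI := injective_directSum hI₁ hI₂
  have hId := denseRange_directSum hI₁d hI₂d
  have h22' : ∀ l ∈ Icc ζm ζp,
      CoerciveOn (-block₂₂ (T l)) ⊤ ∧ (block₂₂ (T l)).IsInvertible := by
    obtain ⟨ε, hε, h⟩ := h22
    exact fun l hl => isInvertible_block₂₂ ⟨ε, hε, h l hl⟩
  have hherm : ∀ l ∈ Icc ζm ζp, IsHermitianForm (T l) := fun l hl => by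
    obtain ⟨Q, K, hQ, hK, hT⟩ :=
      exists_eq_isInvertible_add_isCompactOperator (h22' l hl).2 (hScomp l hl)
    exact isHermitianForm_of_isSelfAdjoint_bullet hI hId (hsa l hl) hQ hK hT
  obtain ⟨L, hL, hLip⟩ := exists_norm_sub_le_of_contDiffOn hsmooth
  have hkerm : (T ζm).ker = ⊥ := LinearMap.ker_eq_bot.mpr hm.injective
  have hkerp : (T ζp).ker = ⊥ := LinearMap.ker_eq_bot.mpr hp.injective
  -- At the endpoints the kernel is trivial, so negative type holds vacuously and the local analysis
  -- covers the compact interval.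
  have hneg' : ∀ μ ∈ Icc ζm ζp, ∀ y, T μ y = 0 → y ≠ 0 →
      ∃ d : ℝ, d < 0 ∧ HasDerivAt (fun l : ℝ => (T l y y).re) d μ := by
    intro μ hμ y hy hy0
    rcases eq_or_ne μ ζm with rfl | hμm
    · exact absurd (hm.injective (by rw [hy, map_zero])) hy0
    rcases eq_or_ne μ ζp with rfl | hμp
    · exact absurd (hp.injective (by rw [hy, map_zero])) hy0
    exact hneg μ ⟨lt_of_le_of_ne hμ.1 hμm.symm, lt_of_le_of_ne hμ.2 hμp⟩ y hy hy0
  have hlocal := fun μ (hμ : μ ∈ Icc ζm ζp) =>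
    exists_ind_transfer_eventually hμ hL (fun l hl => hLip l hl μ hμ) hherm
      (fun l hl => (h22' l hl).2) (fun l hl => (h22' l hl).1) (hScomp μ hμ) (hneg' μ hμ)
  choose! n hn hfin hinv hev using hlocal
  have hspec : ∀ μ ∈ Icc ζm ζp,
      (¬ HasBoundedInverse (bullet (directSum I₁ I₂) (T μ)) ↔
        Module.finrank ℂ (T μ).ker ≠ 0) := by
    intro μ hμ
    have := hfin μ hμ
    rw [not_iff_not, Submodule.finrank_eq_zero]
    exact ⟨ker_eq_bot_of_hasBoundedInverse_bullet hI hId,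
      fun h => hasBoundedInverse_bullet hI hId (hinv μ hμ h)⟩
  have hker0 : ∀ l, (T l).IsInvertible → Module.finrank ℂ (T l).ker = 0 := fun l h => by
    rw [LinearMap.ker_eq_bot.mpr h.injective, finrank_bot]
  have hev' : ∀ μ ∈ Icc ζm ζp, ∀ᶠ l in 𝓝[Icc ζm ζp] μ,
      (l < μ → n l = n μ ∧ Module.finrank ℂ (T l).ker = 0) ∧
      (μ < l → n l = n μ + Module.finrank ℂ (T μ).ker ∧ Module.finrank ℂ (T l).ker = 0) := by
    intro μ hμ
    filter_upwards [hev μ hμ, self_mem_nhdsWithin] with l hl hls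
    refine ⟨fun hlt => ⟨?_, hker0 l (hl.1 hlt).1⟩, fun hlt => ⟨?_, hker0 l (hl.2 hlt).1⟩⟩
    · have := (hl.1 hlt).2
      rw [hn l hls] at this
      exact_mod_cast this
    · have := (hl.2 hlt).2
      rw [hn l hls] at this
      exact_mod_cast this
  have hζm : ζm ∈ Icc ζm ζp := left_mem_Icc.mpr hζ.le
  have hζp : ζp ∈ Icc ζm ζp := right_mem_Icc.mpr hζ.le
  obtain ⟨F, hF, hsum⟩ := exists_finset_eq_add_sum hζ.le hev'
  have hFIoo : ∀ x ∈ F, x ∈ Ioo ζm ζp := by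
    intro x hx
    obtain ⟨hx, hk⟩ := (hF x).mp hx
    refine ⟨lt_of_le_of_ne hx.1 ?_, lt_of_le_of_ne hx.2 ?_⟩
    · rintro rfl
      exact hk (hker0 _ hm)
    · rintro rfl
      exact hk (hker0 _ hp)
  have hFspec : (F : Set ℝ) =
      spectrumIn (fun l : ℝ => bullet (directSum I₁ I₂) (T l)) (Ioo ζm ζp) := by
    ext x
    rw [Finset.mem_coe]
    exact ⟨fun hx => ⟨hFIoo x hx, (hspec x ((hF x).mp hx).1).mpr ((hF x).mp hx).2⟩,
      fun hx => (hF x).mpr ⟨Ioo_subset_Icc_self hx.1,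
        (hspec x (Ioo_subset_Icc_self hx.1)).mp hx.2⟩⟩
  have hkd : ∀ μ ∈ Icc ζm ζp, kernelDim (bullet (directSum I₁ I₂) (T μ)) =
      (Module.finrank ℂ (T μ).ker : ℕ∞) := fun μ hμ => by
    have := hfin μ hμ
    exact kernelDim_bullet hI hId
  refine ⟨⟨fun μ hμ => ?_, fun μ _ => ?_⟩, ?_, ?_, ?_⟩
  · have hμ' := Ioo_subset_Icc_self hμ.1
    rw [hkd μ hμ']
    exact ⟨by exact_mod_cast (hspec μ hμ').mp hμ.2, ENat.natCast_ne_top _⟩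
  -- The spectrum is finite, so deleting `μ` from it leaves a closed set that misses `μ`.
  · rw [← hFspec]
    have h := (F.finite_toSet.subset (sdiff_subset (t := {μ}))).isClosed.isOpen_compl.mem_nhds
      (x := μ) (by simp)
    filter_upwards [nhdsWithin_le_nhds h, self_mem_nhdsWithin] with l hl hne hlF
    exact hl ⟨hlF, hne⟩
  · rw [hn ζm hζm]
    exact ENat.natCast_ne_top _
  · rw [hn ζp hζp]
    exact ENat.natCast_ne_top _
  · rw [totalMultiplicity_eq_sum hFspec, hn ζm hζm, hn ζp hζp, hsum,
      Finset.sum_congr rfl fun μ hμ => hkd μ ((hF μ).mp hμ).1,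
      Finset.sum_congr rfl fun μ hμ => if_pos (hFIoo μ hμ).2, add_comm]
    push_cast
    rfl
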